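/- Let $\lambda>0$ and, for $N\ge 1$, consider the activated random walk with sleeping rate $\lambda$ on the complete graph with $N+1$ vertices, one of which is the boundary. Each active particle performs, independently, a continuous-time simple random walk of jump rate $1$ and is removed when it jumps to the boundary. Each active particle also carries an independent Poisson clock of rate $\lambda$; when the clock rings, the particle falls asleep if it is the only active particle at its vertex, and otherwise nothing happens. A sleeping particle does not move and becomes active as soon as an active particle arrives at its vertex. Consider the discrete-time Markov chain on the stable configurations (every non-boundary vertex is empty or hosts exactly one sleeping particle) in which one step consists of adding an active particle at a uniformly chosen non-boundary vertex (waking the sleeping particle there, if any) and letting the system evolve until all remaining particles are asleep. This chain has a unique stationary distribution; let $\mu^{(N)}$ be the law of the number of sleeping particles under it. Then there is a sequence $(\alpha_N)_{N\in\mathbb N}$ of real numbers, depending only on $\lambda$, with $\alpha_N=O(\sqrt{N\log N})$ as $N\to\infty$, such that $$\lim_{N\to\infty}\mu^{(N)}\big[\rho_c N-\alpha_N,\ \rho_c N+\alpha_N\big]=1,\qquad \rho_c=\frac{\lambda}{1+\lambda}.$$ -/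

import Mathlib

open Filter Topology Asymptotics

noncomputable section

namespace ARW

/-- The state of a non-boundary vertex: it hosts a single sleeping particle, or it hosts
`k` active particles and nothing else (`active 0` is the empty vertex). -/
inductive Site where
  | sleeping : Site
  | active (k : ℕ) : Site

namespace Site

/-- Number of particles, sleeping or active. -/
def particles : Site → ℕ
  | sleeping => 1
  | active k => k

/-- Number of active particles. -/
def numActive : Site → ℕ
  | sleeping => 0
  | active k => k

/-- An active particle arrives; a sleeping particle that is already there wakes up. -/
def arrive : Site → Site
  | sleeping => active 2
  | active k => active (k + 1)

/-- An active particle leaves (only used when there is an active particle). -/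
def depart : Site → Site
  | sleeping => sleeping
  | active k => active (k - 1)

/-- The sleep clock of an active particle rings: the particle falls asleep if it is the only
active particle at its vertex, otherwise nothing happens. -/
def ring : Site → Site
  | active 1 => sleeping
  | s => s

end Site

/-- Particle configurations on the `N` non-boundary vertices. -/
abbrev Config (N : ℕ) : Type := Fin N → Site

/-- The vertices of the complete graph with `N + 1` vertices: the vertex `some x` is a
non-boundary vertex, and `none` is the boundary vertex. -/
abbrev Vertex (N : ℕ) : Type := Option (Fin N)

variable {N : ℕ}

/-- Total number of particles. -/
def particleCount (η : Config N) : ℕ := ∑ x, (η x).particles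

/-- An active particle arrives at a vertex; it disappears at the boundary. -/
def arriveAt (η : Config N) : Vertex N → Config N
  | some y => Function.update η y (η y).arrive
  | none => η

/-- An active particle jumps from `x` to `v`. -/
def jump (η : Config N) (x : Fin N) (v : Vertex N) : Config N :=
  arriveAt (Function.update η x (η x).depart) v

/-- The sleep clock of an active particle at `x` rings. -/
def fallAsleep (η : Config N) (x : Fin N) : Config N :=
  Function.update η x (η x).ring

/-- The generator of the continuous time activated random walk with sleeping rate `lam`:
each active particle performs a simple random walk on the complete graph on `Vertex N` (at
rate `1` it jumps to one of the `N` other vertices, uniformly chosen), and its sleep clock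
rings at rate `lam`. -/
def generator (lam : ℝ) (f : Config N → ℝ) (η : Config N) : ℝ :=
  ∑ x : Fin N, ((η x).numActive : ℝ) *
    ((∑ v ∈ (Finset.univ : Finset (Vertex N)).erase (some x),
        (1 / (N : ℝ)) * (f (jump η x v) - f η))
      + lam * (f (fallAsleep η x) - f η))

/-- The configurations with at most `N + 1` particles. No transition increases the number of
particles, so the dynamics never leaves this finite set. -/
abbrev BddConfig (N : ℕ) : Type := {η : Config N // particleCount η ≤ N + 1}

theorem Site.particles_numActive_injective :
    Function.Injective (fun s : Site => (s.particles, s.numActive)) := by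
  intro s t h
  cases s <;> cases t <;> simp only [Site.particles, Site.numActive, Prod.mk.injEq] at h <;>
    first | rfl | omega | rw [h.1]

instance : Finite (BddConfig N) := by
  let F : BddConfig N → Fin N → Fin (N + 2) × Fin (N + 2) := fun η x =>
    (Fin.ofNat (N + 2) (η.1 x).particles, Fin.ofNat (N + 2) (η.1 x).numActive)
  refine Finite.of_injective F ?_
  intro η ζ h
  apply Subtype.ext
  funext x
  apply Site.particles_numActive_injective
  have key : ∀ ξ : BddConfig N, (ξ.1 x).particles < N + 2 ∧ (ξ.1 x).numActive < N + 2 := by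
    intro ξ
    have h1 : (ξ.1 x).particles ≤ particleCount ξ.1 :=
      Finset.single_le_sum (f := fun x => (ξ.1 x).particles) (fun _ _ => Nat.zero_le _)
        (Finset.mem_univ x)
    have h2 : (ξ.1 x).numActive ≤ (ξ.1 x).particles := by
      cases ξ.1 x <;> simp [Site.particles, Site.numActive]
    have h3 := ξ.2
    omega
  have hx := congrFun h x
  simp only [F, Prod.mk.injEq, Fin.ext_iff, Fin.ofNat] at hx
  rw [Nat.mod_eq_of_lt (key η).1, Nat.mod_eq_of_lt (key ζ).1,
    Nat.mod_eq_of_lt (key η).2, Nat.mod_eq_of_lt (key ζ).2] at hx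
  exact Prod.ext hx.1 hx.2

instance : Fintype (BddConfig N) := Fintype.ofFinite _

instance : DecidableEq (Config N) := Classical.decEq _

/-- The generator as a matrix (the `Q`-matrix of the dynamics). -/
def rateMatrix (N : ℕ) (lam : ℝ) : Matrix (BddConfig N) (BddConfig N) ℝ :=
  fun η ζ => generator lam (fun η' => if η' = ζ.1 then 1 else 0) η.1

/-- The probability that the dynamics started from `η` is in configuration `ζ` at time `t`. -/
def transProb (lam t : ℝ) (η ζ : BddConfig N) : ℝ :=
  NormedSpace.exp (t • rateMatrix N lam) η ζ

/-- The stable configuration with one sleeping particle at every vertex of `A` and no other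
particles. In this way stable configurations are identified with subsets of the vertices. -/
def sleepers (A : Finset (Fin N)) : Config N :=
  fun x => if x ∈ A then Site.sleeping else Site.active 0

theorem particleCount_sleepers (A : Finset (Fin N)) : particleCount (sleepers A) = A.card := by
  have h : ∀ x, (sleepers A x).particles = if x ∈ A then 1 else 0 := by
    intro x
    by_cases hx : x ∈ A <;> simp [sleepers, hx, Site.particles]
  simp [particleCount, h]

theorem particleCount_arriveAt (η : Config N) (x : Fin N) :
    particleCount (arriveAt η (some x)) = particleCount η + 1 := by
  have h : ∀ s : Site, s.arrive.particles = s.particles + 1 := by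
    intro s
    cases s <;> simp [Site.arrive, Site.particles]
  have e : ∀ y, (arriveAt η (some x) y).particles
      = (η y).particles + if y = x then 1 else 0 := by
    intro y
    by_cases hy : y = x
    · subst hy
      simp [arriveAt, h]
    · simp [arriveAt, hy]
  simp [particleCount, e, Finset.sum_add_distrib]

/-- The stable configuration `A` as a state of the dynamics. -/
def stableState (A : Finset (Fin N)) : BddConfig N :=
  ⟨sleepers A, by
    have h := Finset.card_le_univ A
    rw [Fintype.card_fin] at h
    rw [particleCount_sleepers]
    omega⟩

/-- The stable configuration `A` with an active particle added at `x`. -/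
def addedState (A : Finset (Fin N)) (x : Fin N) : BddConfig N :=
  ⟨arriveAt (sleepers A) (some x), by
    have h := Finset.card_le_univ A
    rw [Fintype.card_fin] at h
    rw [particleCount_arriveAt, particleCount_sleepers]
    omega⟩

/-- The probability that the dynamics started from `η` stabilises in the stable
configuration `B`; stable configurations are absorbing, so this is the limit of the
probability to be there at time `t`. -/
def stabProb (lam : ℝ) (η : BddConfig N) (B : Finset (Fin N)) : ℝ :=
  limUnder atTop (fun t : ℝ => transProb lam t η (stableState B))

/-- The transition matrix of the chain of stable configurations: add an active particle at a
uniformly chosen non-boundary vertex and stabilise. -/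
def chainMatrix (N : ℕ) (lam : ℝ) : Matrix (Finset (Fin N)) (Finset (Fin N)) ℝ :=
  fun A B => ∑ x : Fin N, (1 / (N : ℝ)) * stabProb lam (addedState A x) B

/-- `μ` is a stationary distribution of the chain of stable configurations. -/
def IsStationary (lam : ℝ) (μ : Finset (Fin N) → ℝ) : Prop :=
  μ ∈ stdSimplex ℝ (Finset (Fin N)) ∧ Matrix.vecMul μ (chainMatrix N lam) = μ

/-- The probability under `μ` that the number of sleeping particles lies in `[a, b]`. -/
def countProb (μ : Finset (Fin N) → ℝ) (a b : ℝ) : ℝ :=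
  ∑ A : Finset (Fin N), Set.indicator {A | (A.card : ℝ) ∈ Set.Icc a b} μ A

end ARW

end

namespace ARW

/-! ### Semigroup and absorption law of a finite Markov chain -/

section AbsorbingChain

open Matrix NormedSpace

variable {n ι : Type*} [Fintype n] [DecidableEq n] [Fintype ι]

/-! Write ρ = λ/(1+λ) and let Z be `balance`, which at a stable configuration is ρN minus the number
of sleepers. Its weights make the effects of leaving a site and of falling asleep cancel. What
remains is that a jump resets the weight of its target to 0, so each active particle gives Z the
drift -Z/N, whatever the configuration (`siteGenerator_balance`). As increments are bounded, exp(θZ)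
decreases on average once Z ≥ β = 16θN(1+λ), where the drift beats the quadratic error. Below β the
error is paid for by a multiple of N * `particleCount`, which each active particle lowers at mean
rate 1.

Too few sleepers: adding a particle at a uniform vertex contracts exp(θZ) on average above β, so
stationarity bounds its mean (`IsStationary.sum_exp_le`).

Too many sleepers: `activity`, which is Z plus the particle count minus ρN, vanishes at stable
configurations and is at least 1-ρ after an addition. While the count exceeds ρN + β, low activity
forces Z to be very negative, which pushes activity up, so exp(-θ * activity) plus a correction is
superharmonic there. Multiplying by the excess of the count over ρN + β, which never grows, makes
this global. The stationary mean excess S then satisfies S ≤ (S+1)r with 1-r at least of order θ, so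
S = O(1/θ) (`IsStationary.sum_excess_le`).

A Chernoff bound and Markov's inequality at distance 2β, with θβ = 8 log N, give β of order √(N log
N) and an error O(1/log N) (`IsStationary.one_sub_countProb_le_div_log`).

The chain itself is well defined because N * `particleCount` bounds the mean absorption time
(`exists_absorption_law`). Its stationary law is unique because the full configuration is reached
from everywhere (`existsUnique_stationary`). -/

theorem hasDerivAt_exp_smul_mulVec (Q : Matrix n n ℝ) (v : n → ℝ) (i : n) (t : ℝ) :
    HasDerivAt (fun t : ℝ => (exp (t • Q) *ᵥ v) i) ((exp (t • Q) *ᵥ (Q *ᵥ v)) i) t := by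
  let _ : NormedRing (Matrix n n ℝ) := Matrix.linftyOpNormedRing
  let _ : NormedAlgebra ℝ (Matrix n n ℝ) := Matrix.linftyOpNormedAlgebra
  have h := hasDerivAt_exp_smul_const (𝕂 := ℝ) Q t
  let L : Matrix n n ℝ →ₗ[ℝ] ℝ :=
    { toFun := fun M => (M *ᵥ v) i
      map_add' := fun A B => by simp [add_mulVec]
      map_smul' := fun c A => by simp [smul_mulVec] }
  have := (LinearMap.toContinuousLinearMap L).hasFDerivAt.comp_hasDerivAt t h
  rw [mulVec_mulVec]
  exact this

/-- Adding a large multiple of the identity makes `Q` entrywise nonnegative, hence so are all terms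
of the exponential series. The shift commutes with `Q` and only contributes a positive scalar
factor. -/
theorem exp_smul_nonneg {Q : Matrix n n ℝ} (hQ : ∀ i j, i ≠ j → 0 ≤ Q i j) {t : ℝ}
    (ht : 0 ≤ t) (i j : n) : 0 ≤ exp (t • Q) i j := by
  let _ : NormedRing (Matrix n n ℝ) := Matrix.linftyOpNormedRing
  let _ : NormedAlgebra ℝ (Matrix n n ℝ) := Matrix.linftyOpNormedAlgebra
  set c : ℝ := ∑ i, |Q i i|
  set R : Matrix n n ℝ := t • (Q + c • (1 : Matrix n n ℝ)) with hR
  have hR0 : ∀ i j, 0 ≤ R i j := by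
    intro i j
    refine mul_nonneg ht ?_
    by_cases hij : i = j
    · subst hij
      have h1 : |Q i i| ≤ c :=
        Finset.single_le_sum (f := fun i => |Q i i|) (fun _ _ => abs_nonneg _) (Finset.mem_univ i)
      have h2 := neg_abs_le (Q i i)
      simp only [Matrix.add_apply, Matrix.smul_apply, one_apply_eq, smul_eq_mul, mul_one]
      linarith
    · simpa [one_apply_ne hij] using hQ i j hij
  have hpow : ∀ k : ℕ, ∀ i j, 0 ≤ (R ^ k) i j := by
    intro k
    induction k with
    | zero => intro i j; rw [pow_zero, one_apply]; split_ifs <;> norm_num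
    | succ k ih =>
      intro i j
      rw [pow_succ, mul_apply]
      exact Finset.sum_nonneg fun l _ => mul_nonneg (ih _ _) (hR0 _ _)
  have hexpR : 0 ≤ exp R i j := by
    have h : HasSum (fun k : ℕ => ((k.factorial : ℝ)⁻¹ • R ^ k)) (exp R) :=
      exp_series_hasSum_exp' (𝕂 := ℝ) R
    let L : Matrix n n ℝ →ₗ[ℝ] ℝ :=
      { toFun := fun M => M i j
        map_add' := fun A B => rfl
        map_smul' := fun c A => rfl }
    have h2 := (LinearMap.toContinuousLinearMap L).hasSum h
    refine h2.nonneg fun k => ?_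
    exact mul_nonneg (by positivity) (hpow k i j)
  have hsplit : t • Q = R + (-(t * c)) • (1 : Matrix n n ℝ) := by
    rw [hR, smul_add, smul_smul, neg_smul]
    abel
  have hscal : exp ((-(t * c)) • (1 : Matrix n n ℝ)) =
      Real.exp (-(t * c)) • (1 : Matrix n n ℝ) := by
    rw [← Algebra.algebraMap_eq_smul_one, ← Algebra.algebraMap_eq_smul_one, Real.exp_eq_exp_ℝ]
    exact (algebraMap_exp_comm (𝕂 := ℝ) (𝔸 := Matrix n n ℝ) (-(t * c))).symm
  have hcomm : Commute R ((-(t * c)) • (1 : Matrix n n ℝ)) :=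
    (Commute.one_right R).smul_right _
  have : exp (t • Q) = Real.exp (-(t * c)) • exp R := by
    rw [hsplit, Matrix.exp_add_of_commute _ _ hcomm, hscal, mul_smul_comm, mul_one]
  rw [this]
  exact mul_nonneg (Real.exp_pos _).le hexpR

theorem exp_smul_mulVec_mono {Q : Matrix n n ℝ} (hQ : ∀ i j, i ≠ j → 0 ≤ Q i j) {t : ℝ}
    (ht : 0 ≤ t) {v w : n → ℝ} (h : ∀ i, v i ≤ w i) (i : n) :
    (exp (t • Q) *ᵥ v) i ≤ (exp (t • Q) *ᵥ w) i :=
  Finset.sum_le_sum fun j _ => mul_le_mul_of_nonneg_left (h j) (exp_smul_nonneg hQ ht i j)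

/-- The derivative is the semigroup applied to `Q *ᵥ v`, and the semigroup preserves signs. -/
theorem antitoneOn_exp_smul_mulVec {Q : Matrix n n ℝ} (hQ : ∀ i j, i ≠ j → 0 ≤ Q i j)
    {v : n → ℝ} (hv : ∀ i, (Q *ᵥ v) i ≤ 0) (i : n) :
    AntitoneOn (fun t : ℝ => (exp (t • Q) *ᵥ v) i) (Set.Ici 0) := by
  refine antitoneOn_of_hasDerivWithinAt_nonpos (convex_Ici 0)
    (fun t _ => (hasDerivAt_exp_smul_mulVec Q v i t).continuousAt.continuousWithinAt)
    (fun t _ => (hasDerivAt_exp_smul_mulVec Q v i t).hasDerivWithinAt) fun t ht => ?_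
  rw [interior_Ici] at ht
  have := exp_smul_mulVec_mono hQ (le_of_lt ht) (w := 0) hv i
  simpa using this

theorem mulVec_nonpos_of_isMax {Q : Matrix n n ℝ} (hQ : ∀ i j, i ≠ j → 0 ≤ Q i j)
    (hrow : ∀ i, ∑ j, Q i j = 0) {v : n → ℝ} {i : n} (hi : ∀ j, v j ≤ v i) :
    (Q *ᵥ v) i ≤ 0 := by
  have h : (Q *ᵥ v) i = ∑ j, Q i j * (v j - v i) := by
    simp only [mul_sub, Finset.sum_sub_distrib, ← Finset.sum_mul, hrow, zero_mul, sub_zero]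
    rfl
  rw [h]
  refine Finset.sum_nonpos fun j _ => ?_
  by_cases hij : i = j
  · subst hij; simp
  · exact mul_nonpos_of_nonneg_of_nonpos (hQ i j hij) (sub_nonpos.2 (hi j))

/-- A finite continuous time Markov chain with absorbing states `s b`, for which the expected
absorption time is bounded by `T`, has a limiting absorption law `h`. The law is harmonic, and
superharmonic functions decrease on average under it. -/
theorem exists_absorption_law [DecidableEq ι] {Q : Matrix n n ℝ}
    (hQ : ∀ i j, i ≠ j → 0 ≤ Q i j)
    (hrow : ∀ i, ∑ j, Q i j = 0) {s : ι → n} (hs : Function.Injective s)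
    (habs : ∀ b j, Q (s b) j = 0) {T : n → ℝ} (hT : ∀ i, 0 ≤ T i)
    (hQT : ∀ i, i ∉ Set.range s → (Q *ᵥ T) i ≤ -1) :
    ∃ h : n → ι → ℝ,
      (∀ i b, Tendsto (fun t : ℝ => exp (t • Q) i (s b)) atTop (𝓝 (h i b))) ∧
      (∀ i b, 0 ≤ h i b) ∧
      (∀ b, h (s b) b = 1) ∧
      (∀ b i, (Q *ᵥ fun j => h j b) i = 0) ∧
      (∀ f : n → ℝ, (∀ i, (Q *ᵥ f) i ≤ 0) → ∀ i, ∑ b, h i b * f (s b) ≤ f i) := by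
  classical
  have habsV : ∀ b (v : n → ℝ), (Q *ᵥ v) (s b) = 0 := fun b v =>
    Finset.sum_eq_zero fun j _ => mul_eq_zero_of_left (habs b j) (v j)
  have hcol : ∀ (t : ℝ) i j, exp (t • Q) i j = (exp (t • Q) *ᵥ Pi.single j 1) i := by
    intro t i j; simp
  have hzero : ∀ (v : n → ℝ) i, (exp ((0 : ℝ) • Q) *ᵥ v) i = v i := by
    intro v i; rw [zero_smul, exp_zero, one_mulVec]
  have hle : ∀ {f : n → ℝ}, (∀ i, (Q *ᵥ f) i ≤ 0) → ∀ {t : ℝ}, 0 ≤ t → ∀ i,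
      (exp (t • Q) *ᵥ f) i ≤ f i := by
    intro f hf t ht i
    have := antitoneOn_exp_smul_mulVec hQ hf i (Set.mem_Ici.2 le_rfl) (Set.mem_Ici.2 ht) ht
    simpa only [hzero] using this
  -- existence of the limits
  have hlim : ∀ i b, ∃ l, Tendsto (fun t : ℝ => exp (t • Q) i (s b)) atTop (𝓝 l) := by
    intro i b
    -- Minus the indicator of an absorbing state is superharmonic, so the probability of sitting
    -- there increases with time.
    have hsup : ∀ i, (Q *ᵥ (-Pi.single (s b) (1 : ℝ))) i ≤ 0 := by
      intro i
      by_cases hi : i = s b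
      · rw [hi, habsV]
      · refine mulVec_nonpos_of_isMax hQ hrow fun j => ?_
        simp only [Pi.neg_apply, Pi.single_eq_of_ne hi, neg_zero, neg_nonpos]
        exact (Pi.single_nonneg.2 zero_le_one : (0 : n → ℝ) ≤ Pi.single (s b) 1) j
    have hanti := antitoneOn_exp_smul_mulVec hQ hsup i
    have hbdd : ∀ t : ℝ, 0 ≤ t → exp (t • Q) i (s b) ≤ 1 := by
      intro t ht
      have h1 := hle (f := fun _ => 1) (fun i => by simp [mulVec, dotProduct, hrow]) ht i
      refine le_trans ?_ h1
      rw [hcol]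
      refine exp_smul_mulVec_mono hQ ht (fun j => ?_) i
      by_cases hj : j = s b
      · subst hj; simp
      · simp [Pi.single_eq_of_ne hj]
    let g : ℝ → ℝ := fun t => exp ((max t 0) • Q) i (s b)
    have hmono : Monotone g := by
      intro t u htu
      have := hanti (Set.mem_Ici.2 (le_max_right t 0)) (Set.mem_Ici.2 (le_max_right u 0))
        (max_le_max htu le_rfl)
      simp only [mulVec_neg, Pi.neg_apply, neg_le_neg_iff, ← hcol] at this
      exact this
    refine ⟨⨆ t, g t, ?_⟩
    have hb : BddAbove (Set.range g) := by
      refine ⟨1, ?_⟩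
      rintro _ ⟨t, rfl⟩
      exact hbdd _ (le_max_right _ _)
    refine (tendsto_atTop_ciSup hmono hb).congr' ?_
    filter_upwards [eventually_ge_atTop 0] with t ht
    simp [g, max_eq_left ht]
  choose h hh using hlim
  -- the other states are transient
  have htrans : ∀ i j, j ∉ Set.range s →
      Tendsto (fun t : ℝ => exp (t • Q) i j) atTop (𝓝 0) := by
    intro i j hj
    let v : n → ℝ := fun k => if k ∈ Set.range s then 0 else 1
    have hv01 : ∀ k, v k ≤ 1 := fun k => by simp only [v]; split_ifs <;> norm_num
    have hv : ∀ k, (Q *ᵥ v) k ≤ 0 := by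
      intro k
      by_cases hk : k ∈ Set.range s
      · obtain ⟨b, rfl⟩ := hk
        rw [habsV]
      · refine mulVec_nonpos_of_isMax hQ hrow fun l => ?_
        rw [show v k = 1 by simp only [v, if_neg hk]]
        exact hv01 l
    have hTv : ∀ k, (Q *ᵥ T) k ≤ (-v) k := by
      intro k
      by_cases hk : k ∈ Set.range s
      · obtain ⟨b, rfl⟩ := hk
        rw [habsV]; simp [v]
      · simpa only [Pi.neg_apply, v, if_neg hk] using hQT k hk
    -- `u t` is the probability of not being absorbed by time `t`. Since `u` decreases and `T` loses
    -- at least `u` per unit time, `ψ` decreases; hence `t * u t ≤ T i`.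
    let u : ℝ → ℝ := fun t => (exp (t • Q) *ᵥ v) i
    let ψ : ℝ → ℝ := fun t => (exp (t • Q) *ᵥ T) i + t * u t
    have hψ : ∀ t, HasDerivAt ψ ((exp (t • Q) *ᵥ (Q *ᵥ T)) i +
        (1 * u t + t * (exp (t • Q) *ᵥ (Q *ᵥ v)) i)) t := fun t =>
      (hasDerivAt_exp_smul_mulVec Q T i t).add
        ((hasDerivAt_id t).mul (hasDerivAt_exp_smul_mulVec Q v i t))
    have hanti : AntitoneOn ψ (Set.Ici 0) := by
      refine antitoneOn_of_hasDerivWithinAt_nonpos (convex_Ici 0)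
        (fun t _ => (hψ t).continuousAt.continuousWithinAt)
        (fun t _ => (hψ t).hasDerivWithinAt) fun t ht => ?_
      rw [interior_Ici] at ht
      have ht' : 0 ≤ t := le_of_lt ht
      have h1 := exp_smul_mulVec_mono hQ ht' hTv i
      have h2 := exp_smul_mulVec_mono hQ ht' (w := 0) hv i
      rw [mulVec_neg] at h1
      simp only [mulVec_zero, Pi.zero_apply, Pi.neg_apply] at h1 h2
      have h3 := mul_nonpos_of_nonneg_of_nonpos ht' h2
      have h4 : u t = (exp (t • Q) *ᵥ v) i := rfl
      linarith
    have hu : ∀ t : ℝ, 0 < t → u t ≤ T i / t := by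
      intro t ht
      have h1 := hanti (Set.mem_Ici.2 le_rfl) (Set.mem_Ici.2 ht.le) ht.le
      have h2 : ψ 0 = T i := by simp [ψ]
      have h3 := exp_smul_mulVec_mono hQ ht.le (v := 0) hT i
      simp only [mulVec_zero, Pi.zero_apply] at h3
      rw [h2] at h1
      rw [le_div_iff₀ ht]
      simp only [ψ] at h1
      linarith
    refine squeeze_zero' (g := fun t => T i / t) ?_ ?_
      (tendsto_const_nhds.div_atTop tendsto_id)
    · filter_upwards [eventually_ge_atTop 0] with t ht using exp_smul_nonneg hQ ht i j
    · filter_upwards [eventually_gt_atTop 0] with t ht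
      refine le_trans ?_ (hu t ht)
      rw [hcol]
      refine exp_smul_mulVec_mono hQ ht.le (fun k => ?_) i
      by_cases hk : k = j
      · subst hk; simp only [v, if_neg hj, Pi.single_eq_same, le_refl]
      · rw [Pi.single_eq_of_ne hk]
        simp only [v]; split_ifs <;> norm_num
  refine ⟨h, hh, fun i b => ?_, fun b => ?_, fun b i => ?_, fun f hf i => ?_⟩
  · refine ge_of_tendsto (hh i b) ?_
    filter_upwards [eventually_ge_atTop 0] with t ht using exp_smul_nonneg hQ ht i (s b)
  · refine tendsto_nhds_unique (hh (s b) b) ?_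
    have hconst : ∀ t : ℝ, exp (t • Q) (s b) (s b) = 1 := by
      -- Only the zeroth term of the exponential series survives in an absorbing row.
      have hrow0 : ∀ k : ℕ, ∀ t : ℝ, ((t • Q) ^ (k + 1)) (s b) (s b) = 0 := by
        intro k t
        rw [pow_succ', mul_apply]
        exact Finset.sum_eq_zero fun j _ => by simp [habs]
      intro t
      let _ : NormedRing (Matrix n n ℝ) := Matrix.linftyOpNormedRing
      let _ : NormedAlgebra ℝ (Matrix n n ℝ) := Matrix.linftyOpNormedAlgebra
      have h : HasSum (fun k : ℕ => ((k.factorial : ℝ)⁻¹ • (t • Q) ^ k)) (exp (t • Q)) :=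
        exp_series_hasSum_exp' (𝕂 := ℝ) (t • Q)
      let L : Matrix n n ℝ →ₗ[ℝ] ℝ :=
        { toFun := fun M => M (s b) (s b)
          map_add' := fun A B => rfl
          map_smul' := fun c A => rfl }
      have h2 := (LinearMap.toContinuousLinearMap L).hasSum h
      refine h2.unique ?_
      have h3 := hasSum_single (f := fun k : ℕ =>
        L ((k.factorial : ℝ)⁻¹ • (t • Q) ^ k)) 0 (fun k hk => by
          obtain ⟨m, rfl⟩ := Nat.exists_eq_succ_of_ne_zero hk
          rw [map_smul]
          change _ • ((t • Q) ^ (m + 1)) (s b) (s b) = 0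
          rw [hrow0, smul_zero])
      have h4 : L (((0 : ℕ).factorial : ℝ)⁻¹ • (t • Q) ^ 0) = 1 := by
        rw [pow_zero, Nat.factorial_zero, Nat.cast_one, inv_one, one_smul]
        exact one_apply_eq (s b)
      rw [h4] at h3
      exact h3
    simp only [hconst]
    exact tendsto_const_nhds
  -- The semigroup property passes to the limit, making `h` invariant; differentiating at time 0
  -- gives harmonicity.
  · have hinv : ∀ t : ℝ, (exp (t • Q) *ᵥ fun j => h j b) i = h i b := by
      intro t
      have h1 : Tendsto (fun r : ℝ => ∑ j, exp (t • Q) i j * exp (r • Q) j (s b)) atTop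
          (𝓝 (∑ j, exp (t • Q) i j * h j b)) :=
        tendsto_finsetSum _ fun j _ => (hh j b).const_mul _
      have h2 : Tendsto (fun r : ℝ => exp ((t + r) • Q) i (s b)) atTop (𝓝 (h i b)) :=
        (hh i b).comp (tendsto_atTop_add_const_left _ t tendsto_id)
      refine tendsto_nhds_unique h1 (h2.congr fun r => ?_)
      have hcomm : Commute (t • Q) (r • Q) :=
        ((Commute.refl Q).smul_left t).smul_right r
      rw [add_smul, Matrix.exp_add_of_commute _ _ hcomm, mul_apply]
    have hd := hasDerivAt_exp_smul_mulVec Q (fun j => h j b) i 0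
    rw [hzero] at hd
    simp only [hinv] at hd
    exact hd.unique (hasDerivAt_const _ _)
  · have h1 : Tendsto (fun t : ℝ => (exp (t • Q) *ᵥ f) i) atTop
        (𝓝 (∑ b, h i b * f (s b))) := by
      have hsplit : ∀ t : ℝ, (exp (t • Q) *ᵥ f) i =
          (∑ b, exp (t • Q) i (s b) * f (s b)) +
            ∑ j ∈ Finset.univ.filter (fun j => j ∉ Set.range s), exp (t • Q) i j * f j := by
        intro t
        have himg : Finset.univ.filter (fun j => j ∈ Set.range s) = Finset.univ.image s := by
          ext j; simp
        rw [← Finset.sum_image (s := Finset.univ) (g := s)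
          (f := fun j => exp (t • Q) i j * f j) (fun _ _ _ _ h => hs h), ← himg,
          Finset.sum_filter_add_sum_filter_not]
        rfl
      have h2 : Tendsto (fun t : ℝ => ∑ j ∈ Finset.univ.filter (fun j => j ∉ Set.range s),
          exp (t • Q) i j * f j) atTop (𝓝 0) := by
        rw [← Finset.sum_const_zero (s := Finset.univ.filter (fun j => j ∉ Set.range s))]
        refine tendsto_finsetSum _ fun j hj => ?_
        simpa using (htrans i j (Finset.mem_filter.1 hj).2).mul_const (f j)
      have h3 : Tendsto (fun t : ℝ => ∑ b, exp (t • Q) i (s b) * f (s b)) atTop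
          (𝓝 (∑ b, h i b * f (s b))) :=
        tendsto_finsetSum _ fun b _ => (hh i b).mul_const _
      simpa only [hsplit, add_zero] using h3.add h2
    refine le_of_tendsto h1 ?_
    filter_upwards [eventually_ge_atTop 0] with t ht using hle hf ht i

end AbsorbingChain

end ARW

namespace ARW

/-! ### Stationary distributions of finite chains -/

section Stationary

open Matrix

variable {ι : Type*} [Fintype ι]

/-- The triangle inequality gives `≤` pointwise in one direction, and unit row sums make both sides
have the same total, so equality holds everywhere. -/
theorem abs_vecMul_eq_of_vecMul_eq {K : Matrix ι ι ℝ} (hK : ∀ a b, 0 ≤ K a b)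
    (hrow : ∀ a, ∑ b, K a b = 1) {ν : ι → ℝ} (hν : ν ᵥ* K = ν) :
    (fun a => |ν a|) ᵥ* K = fun a => |ν a| := by
  have hle : ∀ b ∈ Finset.univ, |ν b| ≤ ((fun a => |ν a|) ᵥ* K) b := by
    intro b _
    calc |ν b| = |(ν ᵥ* K) b| := by rw [hν]
      _ ≤ ∑ a, |ν a * K a b| := Finset.abs_sum_le_sum_abs _ _
      _ = ((fun a => |ν a|) ᵥ* K) b :=
        Finset.sum_congr rfl fun a _ => by rw [abs_mul, abs_of_nonneg (hK a b)]
  have hsum : ∑ b, |ν b| = ∑ b, ((fun a => |ν a|) ᵥ* K) b := by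
    change _ = ∑ b, ∑ a, |ν a| * K a b
    rw [Finset.sum_comm]
    simp only [← Finset.mul_sum, hrow, mul_one]
  funext b
  exact ((Finset.sum_eq_sum_iff_of_le hle).1 hsum b (Finset.mem_univ b)).symm

theorem pos_of_stationary_of_reaches {K : Matrix ι ι ℝ} (hK : ∀ a b, 0 ≤ K a b)
    {ν : ι → ℝ} (hν0 : ∀ a, 0 ≤ ν a) (hν : ν ᵥ* K = ν) {a z : ι}
    (h : Relation.ReflTransGen (fun a b => 0 < K a b) a z) (ha : 0 < ν a) : 0 < ν z := by
  induction h with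
  | refl => exact ha
  | tail _ hbc ih =>
    rename_i b c _
    rw [← hν]
    exact (mul_pos ih hbc).trans_le
      (Finset.single_le_sum (f := fun a => ν a * K a c)
        (fun a _ => mul_nonneg (hν0 a) (hK a c)) (Finset.mem_univ b))

/-- A finite Markov chain with a state that is reached from every state has exactly one
stationary distribution. -/
theorem existsUnique_stationary [DecidableEq ι] {K : Matrix ι ι ℝ} (hK : ∀ a b, 0 ≤ K a b)
    (hrow : ∀ a, ∑ b, K a b = 1) {z : ι}
    (hz : ∀ a, Relation.ReflTransGen (fun a b => 0 < K a b) a z) :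
    ∃! μ : ι → ℝ, μ ∈ stdSimplex ℝ ι ∧ μ ᵥ* K = μ := by
  have hex : ∃ ν : ι → ℝ, ν ≠ 0 ∧ ν ᵥ* K = ν := by
    -- Constants lie in the right kernel of `K - 1`, so the left kernel is nontrivial too.
    have hdet : (K - 1).det = 0 := by
      refine exists_mulVec_eq_zero_iff.1 ⟨fun _ => 1, fun h => one_ne_zero (congrFun h z), ?_⟩
      rw [sub_mulVec, one_mulVec]
      funext a
      simp [mulVec, dotProduct, hrow]
    obtain ⟨ν, hν, h⟩ := exists_vecMul_eq_zero_iff.2 hdet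
    refine ⟨ν, hν, ?_⟩
    rwa [vecMul_sub, vecMul_one, sub_eq_zero] at h
  obtain ⟨ν, hν0, hν⟩ := hex
  have habs := abs_vecMul_eq_of_vecMul_eq hK hrow hν
  have hpos : 0 < ∑ a, |ν a| := by
    obtain ⟨a, ha⟩ := Function.ne_iff.1 hν0
    exact Finset.sum_pos' (fun _ _ => abs_nonneg _) ⟨a, Finset.mem_univ a, abs_pos.2 ha⟩
  refine ⟨(∑ a, |ν a|)⁻¹ • fun a => |ν a|, ⟨⟨fun a => ?_, ?_⟩, ?_⟩, ?_⟩
  · exact mul_nonneg (inv_nonneg.2 hpos.le) (abs_nonneg _)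
  · simp only [Pi.smul_apply, smul_eq_mul, ← Finset.mul_sum]
    exact inv_mul_cancel₀ hpos.ne'
  · rw [smul_vecMul, habs]
  intro μ ⟨hμ, hμK⟩
  set π : ι → ℝ := (∑ a, |ν a|)⁻¹ • fun a => |ν a| with hπ
  have hπK : π ᵥ* K = π := by rw [hπ, smul_vecMul, habs]
  have hπ1 : ∑ a, π a = 1 := by
    simp only [hπ, Pi.smul_apply, smul_eq_mul, ← Finset.mul_sum]
    exact inv_mul_cancel₀ hpos.ne'
  set δ : ι → ℝ := μ - π with hδ
  have hδK : δ ᵥ* K = δ := by rw [hδ, sub_vecMul, hμK, hπK]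
  have hδabs := abs_vecMul_eq_of_vecMul_eq hK hrow hδK
  have hδsum : ∑ a, δ a = 0 := by
    simp [hδ, Finset.sum_sub_distrib, hμ.2, hπ1]
  -- Twice the positive and negative parts of `δ`, both invariant. If neither vanished, both would
  -- charge `z`, which is impossible; so `δ` has constant sign and, having total 0, vanishes.
  set p : ι → ℝ := (fun a => |δ a|) + δ with hp
  set q : ι → ℝ := (fun a => |δ a|) - δ with hq
  have hpK : p ᵥ* K = p := by rw [hp, add_vecMul, hδabs, hδK]
  have hqK : q ᵥ* K = q := by rw [hq, sub_vecMul, hδabs, hδK]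
  have hp0 : ∀ a, 0 ≤ p a := fun a => by
    have := neg_abs_le (δ a)
    simp only [hp, Pi.add_apply]; linarith
  have hq0 : ∀ a, 0 ≤ q a := fun a => by
    have := le_abs_self (δ a)
    simp only [hq, Pi.sub_apply]; linarith
  have hδ0 : ∀ a, δ a = 0 := by
    have key : (∀ a, p a = 0) ∨ (∀ a, q a = 0) := by
      by_contra! hcon
      obtain ⟨⟨a, ha⟩, b, hb⟩ := hcon
      have h1 := pos_of_stationary_of_reaches hK hp0 hpK (hz a) ((hp0 a).lt_of_ne' ha)
      have h2 := pos_of_stationary_of_reaches hK hq0 hqK (hz b) ((hq0 b).lt_of_ne' hb)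
      simp only [hp, hq, Pi.add_apply, Pi.sub_apply] at h1 h2
      rcases abs_cases (δ z) with h | h <;> linarith
    rcases key with h | h
    · have hle : ∀ a ∈ Finset.univ, 0 ≤ -δ a := fun a _ => by
        have h1 := h a
        have h2 := abs_nonneg (δ a)
        simp only [hp, Pi.add_apply] at h1; linarith
      have := (Finset.sum_eq_zero_iff_of_nonneg hle).1 (by simp [hδsum])
      intro a; simpa using this a (Finset.mem_univ a)
    · have hle : ∀ a ∈ Finset.univ, 0 ≤ δ a := fun a _ => by
        have h1 := h a
        have h2 := abs_nonneg (δ a)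
        simp only [hq, Pi.sub_apply] at h1; linarith
      have := (Finset.sum_eq_zero_iff_of_nonneg hle).1 hδsum
      intro a; exact this a (Finset.mem_univ a)
  funext a
  exact sub_eq_zero.1 (hδ0 a)

end Stationary

end ARW

namespace ARW

open Matrix

/-! ### The generator acting on functions of the configuration -/

section Generator

variable {N : ℕ}

/-- The contribution to the generator of a single active particle at `x`. -/
noncomputable def siteGenerator (lam : ℝ) (f : Config N → ℝ) (η : Config N) (x : Fin N) : ℝ :=
  (∑ v ∈ (Finset.univ : Finset (Vertex N)).erase (some x),
      (1 / (N : ℝ)) * (f (jump η x v) - f η)) + lam * (f (fallAsleep η x) - f η)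

theorem generator_eq_sum_siteGenerator (lam : ℝ) (f : Config N → ℝ) (η : Config N) :
    generator lam f η = ∑ x, ((η x).numActive : ℝ) * siteGenerator lam f η x := rfl

theorem generator_nonpos {lam : ℝ} {f : Config N → ℝ} {η : Config N}
    (h : ∀ x, (η x).numActive ≠ 0 → siteGenerator lam f η x ≤ 0) : generator lam f η ≤ 0 := by
  rw [generator_eq_sum_siteGenerator]
  refine Finset.sum_nonpos fun x _ => ?_
  by_cases hx : (η x).numActive = 0
  · simp [hx]
  · exact mul_nonpos_of_nonneg_of_nonpos (Nat.cast_nonneg _) (h x hx)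

/-- The sum of a weight over the sites. -/
noncomputable def siteSum (w : Site → ℝ) (η : Config N) : ℝ := ∑ x, w (η x)

theorem siteSum_update (w : Site → ℝ) (η : Config N) (x : Fin N) (s : Site) :
    siteSum w (Function.update η x s) = siteSum w η + (w s - w (η x)) := by
  have h : ∀ y, w (Function.update η x s y) = w (η y) + if y = x then w s - w (η x) else 0 := by
    intro y
    by_cases hy : y = x
    · subst hy; simp
    · simp [hy]
  simp [siteSum, h, Finset.sum_add_distrib]

theorem siteSum_jump_some (w : Site → ℝ) (η : Config N) {x y : Fin N} (hxy : y ≠ x) :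
    siteSum w (jump η x (some y)) =
      siteSum w η + (w (η x).depart - w (η x)) + (w (η y).arrive - w (η y)) := by
  simp only [jump, arriveAt]
  rw [siteSum_update, siteSum_update, Function.update_of_ne hxy]

theorem siteSum_jump_none (w : Site → ℝ) (η : Config N) (x : Fin N) :
    siteSum w (jump η x none) = siteSum w η + (w (η x).depart - w (η x)) := by
  simp only [jump, arriveAt]
  rw [siteSum_update]

theorem siteSum_fallAsleep (w : Site → ℝ) (η : Config N) (x : Fin N) :
    siteSum w (fallAsleep η x) = siteSum w η + (w (η x).ring - w (η x)) :=
  siteSum_update w η x _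

theorem sum_erase_some (g : Vertex N → ℝ) (x : Fin N) :
    ∑ v ∈ (Finset.univ : Finset (Vertex N)).erase (some x), g v =
      g none + ∑ y ∈ Finset.univ.erase x, g (some y) := by
  have h1 := Finset.add_sum_erase Finset.univ g (Finset.mem_univ (some x))
  have h2 := Finset.add_sum_erase Finset.univ (fun y => g (some y)) (Finset.mem_univ x)
  rw [Fintype.sum_option] at h1
  linarith

theorem particleCount_eq_siteSum (η : Config N) :
    (particleCount η : ℝ) = siteSum (fun s => (s.particles : ℝ)) η := by
  simp [particleCount, siteSum]

theorem particleCount_jump_some {η : Config N} {x y : Fin N} (hx : (η x).numActive ≠ 0)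
    (hxy : y ≠ x) : particleCount (jump η x (some y)) = particleCount η := by
  have h := siteSum_jump_some (fun s => (s.particles : ℝ)) η hxy
  rw [← particleCount_eq_siteSum, ← particleCount_eq_siteSum] at h
  have h1 : (((η x).depart.particles : ℕ) : ℝ) - (η x).particles = -1 := by
    rcases hs : η x with _ | _ | k <;> simp [hs, Site.numActive] at hx
    simp [Site.depart, Site.particles]
  have h2 : (((η y).arrive.particles : ℕ) : ℝ) - (η y).particles = 1 := by
    rcases η y with _ | k <;> simp [Site.arrive, Site.particles]; norm_num
  have : (particleCount (jump η x (some y)) : ℝ) = particleCount η := by linarith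
  exact_mod_cast this

theorem particleCount_jump_none {η : Config N} {x : Fin N} (hx : (η x).numActive ≠ 0) :
    particleCount (jump η x none) + 1 = particleCount η := by
  have h := siteSum_jump_none (fun s => (s.particles : ℝ)) η x
  rw [← particleCount_eq_siteSum, ← particleCount_eq_siteSum] at h
  have h1 : (((η x).depart.particles : ℕ) : ℝ) - (η x).particles = -1 := by
    rcases hs : η x with _ | _ | k <;> simp [hs, Site.numActive] at hx
    simp [Site.depart, Site.particles]
  have : (particleCount (jump η x none) : ℝ) + 1 = particleCount η := by linarith
  exact_mod_cast this

theorem particleCount_fallAsleep (η : Config N) (x : Fin N) :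
    particleCount (fallAsleep η x) = particleCount η := by
  have h := siteSum_fallAsleep (fun s => (s.particles : ℝ)) η x
  rw [← particleCount_eq_siteSum, ← particleCount_eq_siteSum] at h
  have h1 : (((η x).ring.particles : ℕ) : ℝ) - (η x).particles = 0 := by
    rcases η x with _ | _ | _ | k <;> simp [Site.ring, Site.particles]
  have : (particleCount (fallAsleep η x) : ℝ) = particleCount η := by linarith
  exact_mod_cast this

theorem particleCount_jump_le {η : Config N} {x : Fin N} (hx : (η x).numActive ≠ 0)
    {v : Vertex N} (hv : v ≠ some x) : particleCount (jump η x v) ≤ particleCount η := by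
  rcases v with _ | y
  · have := particleCount_jump_none hx; omega
  · exact (particleCount_jump_some hx fun h => hv (by rw [h])).le

/-- The truncation to `BddConfig` loses nothing: moves with nonzero rate start from an active
particle and never raise the particle count. -/
theorem rateMatrix_mulVec (lam : ℝ) (f : Config N → ℝ) (η : BddConfig N) :
    (rateMatrix N lam *ᵥ fun ζ => f ζ.1) η = generator lam f η.1 := by
  have hind : ∀ ξ : Config N, particleCount ξ ≤ N + 1 →
      ∑ ζ : BddConfig N, (if ξ = ζ.1 then (1 : ℝ) else 0) * f ζ.1 = f ξ := by
    intro ξ hξ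
    rw [Finset.sum_eq_single (⟨ξ, hξ⟩ : BddConfig N)]
    · simp
    · intro ζ _ hζ
      rw [if_neg (fun h => hζ (Subtype.ext h.symm)), zero_mul]
    · intro h; exact absurd (Finset.mem_univ _) h
  have hsite : ∀ x, (η.1 x).numActive ≠ 0 →
      ∑ ζ : BddConfig N, siteGenerator lam (fun η' => if η' = ζ.1 then 1 else 0) η.1 x * f ζ.1
        = siteGenerator lam f η.1 x := by
    intro x hx
    simp only [siteGenerator, add_mul, Finset.sum_add_distrib, Finset.sum_mul]
    rw [Finset.sum_comm]
    congr 1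
    · refine Finset.sum_congr rfl fun v hv => ?_
      have hle := (particleCount_jump_le hx (Finset.ne_of_mem_erase hv)).trans η.2
      rw [← hind _ hle, ← hind _ η.2, ← Finset.sum_sub_distrib, Finset.mul_sum]
      exact Finset.sum_congr rfl fun ζ _ => by ring
    · have hle := (particleCount_fallAsleep η.1 x).le.trans η.2
      rw [← hind _ hle, ← hind _ η.2, ← Finset.sum_sub_distrib, Finset.mul_sum]
      exact Finset.sum_congr rfl fun ζ _ => by ring
  change ∑ ζ : BddConfig N, generator lam (fun η' => if η' = ζ.1 then 1 else 0) η.1 * f ζ.1 = _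
  simp only [generator_eq_sum_siteGenerator, Finset.sum_mul]
  rw [Finset.sum_comm]
  refine Finset.sum_congr rfl fun x _ => ?_
  by_cases hx : (η.1 x).numActive = 0
  · simp [hx]
  · rw [← hsite x hx, Finset.mul_sum]
    exact Finset.sum_congr rfl fun ζ _ => by ring

theorem siteGenerator_nonneg_of_isMin {lam : ℝ} (hlam : 0 ≤ lam) {f : Config N → ℝ}
    {η : Config N} (h : ∀ ξ, f η ≤ f ξ) (x : Fin N) : 0 ≤ siteGenerator lam f η x :=
  add_nonneg (Finset.sum_nonneg fun _ _ => mul_nonneg (by positivity) (sub_nonneg.2 (h _)))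
    (mul_nonneg hlam (sub_nonneg.2 (h _)))

theorem generator_nonneg_of_isMin {lam : ℝ} (hlam : 0 ≤ lam) {f : Config N → ℝ}
    {η : Config N} (h : ∀ ξ, f η ≤ f ξ) : 0 ≤ generator lam f η :=
  Finset.sum_nonneg fun x _ =>
    mul_nonneg (Nat.cast_nonneg _) (siteGenerator_nonneg_of_isMin hlam h x)

theorem rateMatrix_nonneg {lam : ℝ} (hlam : 0 ≤ lam) {η ζ : BddConfig N} (h : η ≠ ζ) :
    0 ≤ rateMatrix N lam η ζ := by
  refine generator_nonneg_of_isMin hlam fun ξ => ?_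
  rw [if_neg fun h' => h (Subtype.ext h')]
  split_ifs <;> norm_num

theorem rateMatrix_row_sum (lam : ℝ) (η : BddConfig N) : ∑ ζ, rateMatrix N lam η ζ = 0 := by
  have h := rateMatrix_mulVec lam (fun _ => (1 : ℝ)) η
  simpa [mulVec, dotProduct, generator] using h

theorem numActive_sleepers (A : Finset (Fin N)) (x : Fin N) :
    (sleepers A x).numActive = 0 := by
  simp only [sleepers]; split_ifs <;> rfl

theorem rateMatrix_stableState (lam : ℝ) (A : Finset (Fin N)) (ζ : BddConfig N) :
    rateMatrix N lam (stableState A) ζ = 0 := by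
  simp [rateMatrix, generator, stableState, numActive_sleepers]

theorem stableState_injective : Function.Injective (stableState (N := N)) := by
  intro A B h
  have h1 : sleepers A = sleepers B := congrArg Subtype.val h
  ext x
  have h2 := congrFun h1 x
  by_cases hA : x ∈ A <;> by_cases hB : x ∈ B <;> simp_all [sleepers]

theorem exists_numActive_ne_zero {η : BddConfig N} (h : η ∉ Set.range (stableState (N := N))) :
    ∃ x, (η.1 x).numActive ≠ 0 := by
  classical
  by_contra! hcon
  refine h ⟨Finset.univ.filter fun x => η.1 x = Site.sleeping, Subtype.ext ?_⟩
  funext x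
  have hx := hcon x
  rcases hs : η.1 x with _ | k
  · simp [stableState, sleepers, hs]
  · rw [hs] at hx
    simp only [Site.numActive] at hx
    subst hx
    simp [stableState, sleepers, hs]

theorem siteGenerator_particleCount (lam : ℝ) {η : Config N} {x : Fin N}
    (hx : (η x).numActive ≠ 0) :
    siteGenerator lam (fun η => (particleCount η : ℝ)) η x = -(1 / N) := by
  simp only [siteGenerator, particleCount_fallAsleep]
  rw [sum_erase_some, Finset.sum_eq_zero, ← particleCount_jump_none hx]
  · push_cast; ring
  · intro y hy
    rw [particleCount_jump_some hx (Finset.ne_of_mem_erase hy)]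
    ring

theorem siteGenerator_const_mul (lam c : ℝ) (f : Config N → ℝ) (η : Config N) (x : Fin N) :
    siteGenerator lam (fun η => c * f η) η x = c * siteGenerator lam f η x := by
  simp only [siteGenerator, mul_add, Finset.mul_sum]
  congr 1
  · exact Finset.sum_congr rfl fun v _ => by ring
  · ring

theorem siteGenerator_add (lam : ℝ) (f g : Config N → ℝ) (η : Config N) (x : Fin N) :
    siteGenerator lam (fun η => f η + g η) η x =
      siteGenerator lam f η x + siteGenerator lam g η x := by
  have : siteGenerator lam (fun η => f η + g η) η x =
      (∑ v ∈ (Finset.univ : Finset (Vertex N)).erase (some x),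
        ((1 / (N : ℝ)) * (f (jump η x v) - f η) + (1 / (N : ℝ)) * (g (jump η x v) - g η))) +
      (lam * (f (fallAsleep η x) - f η) + lam * (g (fallAsleep η x) - g η)) := by
    simp only [siteGenerator]
    congr 1
    · exact Finset.sum_congr rfl fun v _ => by ring
    · ring
  rw [this, Finset.sum_add_distrib]
  simp only [siteGenerator]
  ring

theorem cast_pos_of_fin (x : Fin N) : (0 : ℝ) < N := Nat.cast_pos.2 x.pos

/-- This function serves twice: it bounds the mean stabilisation time, and its multiples absorb
bounded positive errors in later drift estimates. -/
theorem siteGenerator_mul_particleCount (lam : ℝ) {η : Config N} {x : Fin N}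
    (hx : (η x).numActive ≠ 0) :
    siteGenerator lam (fun η => (N : ℝ) * particleCount η) η x = -1 := by
  have hN := (cast_pos_of_fin x).ne'
  rw [siteGenerator_const_mul, siteGenerator_particleCount lam hx]
  field_simp

/-! ### Stabilisation and the chain of stable configurations -/

theorem exists_stabilisation_law {lam : ℝ} (hlam : 0 ≤ lam) :
    (∀ (η : BddConfig N) B, 0 ≤ stabProb lam η B) ∧
    (∀ B : Finset (Fin N), stabProb lam (stableState B) B = 1) ∧
    (∀ (B : Finset (Fin N)) η, (rateMatrix N lam *ᵥ fun ζ => stabProb lam ζ B) η = 0) ∧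
    (∀ f : BddConfig N → ℝ, (∀ η, (rateMatrix N lam *ᵥ f) η ≤ 0) → ∀ η,
      ∑ B, stabProb lam η B * f (stableState B) ≤ f η) := by
  obtain ⟨h, hlim, h0, h1, hharm, hsup⟩ := exists_absorption_law
    (Q := rateMatrix N lam) (s := stableState) (T := fun η => (N : ℝ) * particleCount η.1)
    (fun η ζ hne => rateMatrix_nonneg hlam hne) (rateMatrix_row_sum lam) stableState_injective
    (rateMatrix_stableState lam) (fun η => by positivity) (fun η hη => by
      rw [rateMatrix_mulVec lam (fun η => (N : ℝ) * particleCount η),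
        generator_eq_sum_siteGenerator]
      obtain ⟨x, hx⟩ := exists_numActive_ne_zero hη
      have hterm : ∀ y, ((η.1 y).numActive : ℝ) *
          siteGenerator lam (fun η => (N : ℝ) * particleCount η) η.1 y
            = -((η.1 y).numActive : ℝ) := by
        intro y
        by_cases hy : (η.1 y).numActive = 0
        · simp [hy]
        · rw [siteGenerator_mul_particleCount lam hy]; ring
      simp only [hterm, Finset.sum_neg_distrib, neg_le_neg_iff]
      have h1 : (1 : ℝ) ≤ (η.1 x).numActive := by
        exact_mod_cast Nat.one_le_iff_ne_zero.2 hx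
      exact h1.trans (Finset.single_le_sum (f := fun y => ((η.1 y).numActive : ℝ))
        (fun _ _ => Nat.cast_nonneg _) (Finset.mem_univ x)))
  have hstab : ∀ η B, stabProb lam η B = h η B := fun η B => (hlim η B).limUnder_eq
  refine ⟨fun η B => ?_, fun B => ?_, fun B η => ?_, fun f hf η => ?_⟩
  · rw [hstab]; exact h0 η B
  · rw [hstab]; exact h1 B
  · simp only [hstab]; exact hharm B η
  · simp only [hstab]; exact hsup f hf η

theorem stabProb_nonneg {lam : ℝ} (hlam : 0 ≤ lam) (η : BddConfig N) (B : Finset (Fin N)) :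
    0 ≤ stabProb lam η B := (exists_stabilisation_law hlam).1 η B

theorem sum_stabProb_mul_le {lam : ℝ} (hlam : 0 ≤ lam) {f : Config N → ℝ}
    (hf : ∀ η : BddConfig N, generator lam f η.1 ≤ 0) (η : BddConfig N) :
    ∑ B, stabProb lam η B * f (sleepers B) ≤ f η.1 :=
  (exists_stabilisation_law hlam).2.2.2 (fun ζ => f ζ.1)
    (fun ζ => by rw [rateMatrix_mulVec]; exact hf ζ) η

theorem sum_stabProb {lam : ℝ} (hlam : 0 ≤ lam) (η : BddConfig N) :
    ∑ B, stabProb lam η B = 1 := by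
  -- Both constants 1 and -1 are superharmonic, giving the two inequalities.
  have h1 := sum_stabProb_mul_le hlam (f := fun _ => 1) (fun ζ => by simp [generator]) η
  have h2 := sum_stabProb_mul_le hlam (f := fun _ => -1) (fun ζ => by simp [generator]) η
  simp only [mul_one, mul_neg, Finset.sum_neg_distrib] at h1 h2
  linarith

/-- If the value at `η` were 0, harmonicity there would make a sum of nonnegative terms vanish,
including the one for `ζ`. -/
theorem stabProb_pos_of_rateMatrix_pos {lam : ℝ} (hlam : 0 ≤ lam) {η ζ : BddConfig N}
    {B : Finset (Fin N)} (hr : 0 < rateMatrix N lam η ζ)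
    (hζ : 0 < stabProb lam ζ B) : 0 < stabProb lam η B := by
  refine (stabProb_nonneg hlam η B).lt_of_ne' fun h => ?_
  have hharm : ∑ ξ, rateMatrix N lam η ξ * stabProb lam ξ B = 0 :=
    (exists_stabilisation_law hlam).2.2.1 B η
  have hnn : ∀ ξ ∈ Finset.univ, 0 ≤ rateMatrix N lam η ξ * stabProb lam ξ B := by
    intro ξ _
    by_cases hξ : η = ξ
    · subst hξ; rw [h, mul_zero]
    · exact mul_nonneg (rateMatrix_nonneg hlam hξ) (stabProb_nonneg hlam ξ B)
  have := (Finset.sum_eq_zero_iff_of_nonneg hnn).1 hharm ζ (Finset.mem_univ ζ)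
  exact (mul_pos hr hζ).ne' this

theorem rateMatrix_pos_of_fallAsleep {lam : ℝ} (hlam : 0 < lam) {η ζ : BddConfig N} {x : Fin N}
    (hne : η ≠ ζ) (hx : (η.1 x).numActive ≠ 0) (h : fallAsleep η.1 x = ζ.1) :
    0 < rateMatrix N lam η ζ := by
  set f : Config N → ℝ := fun η' => if η' = ζ.1 then 1 else 0 with hf
  have hη : f η.1 = 0 := if_neg fun h' => hne (Subtype.ext h')
  have hζ : f ζ.1 = 1 := if_pos rfl
  have hmin : ∀ ξ : Config N, f η.1 ≤ f ξ := by
    intro ξ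
    rw [hη, hf]
    dsimp only
    split_ifs <;> norm_num
  have hsite : 0 < siteGenerator lam f η.1 x := by
    refine add_pos_of_nonneg_of_pos
      (Finset.sum_nonneg fun _ _ => mul_nonneg (by positivity) (sub_nonneg.2 (hmin _))) ?_
    rw [h, hη, hζ, sub_zero, mul_one]
    exact hlam
  change 0 < generator lam f η.1
  rw [generator_eq_sum_siteGenerator]
  exact Finset.sum_pos' (fun y _ => mul_nonneg (Nat.cast_nonneg _)
    (siteGenerator_nonneg_of_isMin hlam.le hmin y)) ⟨x, Finset.mem_univ x,
      mul_pos (Nat.cast_pos.2 (Nat.pos_of_ne_zero hx)) hsite⟩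

/-- A particle added at an empty vertex is alone there, so it may fall asleep at once. -/
theorem stabProb_addedState_insert_pos {lam : ℝ} (hlam : 0 < lam) {A : Finset (Fin N)}
    {x : Fin N} (hx : x ∉ A) : 0 < stabProb lam (addedState A x) (insert x A) := by
  have hact : (addedState A x).1 x = Site.active 1 := by
    simp [addedState, arriveAt, sleepers, hx, Site.arrive]
  have hsleep : fallAsleep (addedState A x).1 x = (stableState (insert x A)).1 := by
    funext y
    by_cases hy : y = x
    · subst hy
      simp only [fallAsleep, Function.update_self, hact, Site.ring]
      simp [stableState, sleepers]
    · simp [fallAsleep, hy, addedState, arriveAt, stableState, sleepers]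
  have hne : addedState A x ≠ stableState (insert x A) := by
    intro h
    rw [h] at hact
    simp [stableState, sleepers] at hact
  refine stabProb_pos_of_rateMatrix_pos hlam.le
    (rateMatrix_pos_of_fallAsleep hlam hne ?_ hsleep)
    (by rw [(exists_stabilisation_law hlam.le).2.1]; exact one_pos)
  rw [hact]
  exact one_ne_zero

theorem chainMatrix_nonneg {lam : ℝ} (hlam : 0 ≤ lam) (A B : Finset (Fin N)) :
    0 ≤ chainMatrix N lam A B :=
  Finset.sum_nonneg fun x _ => mul_nonneg (by positivity) (stabProb_nonneg hlam _ B)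

theorem chainMatrix_row_sum (hN : 1 ≤ N) {lam : ℝ} (hlam : 0 ≤ lam) (A : Finset (Fin N)) :
    ∑ B, chainMatrix N lam A B = 1 := by
  have hN' : (N : ℝ) ≠ 0 := by positivity
  simp only [chainMatrix]
  rw [Finset.sum_comm]
  simp only [← Finset.mul_sum, sum_stabProb hlam]
  simp [hN']

theorem chainMatrix_reaches_univ {lam : ℝ} (hlam : 0 < lam) (A : Finset (Fin N)) :
    Relation.ReflTransGen (fun A B => 0 < chainMatrix N lam A B) A Finset.univ := by
  have key : ∀ s : Finset (Fin N),
      Relation.ReflTransGen (fun A B => 0 < chainMatrix N lam A B) A (A ∪ s) := by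
    intro s
    induction s using Finset.induction_on with
    | empty => rw [Finset.union_empty]
    | insert x s _ ih =>
      rw [Finset.union_insert]
      by_cases hx : x ∈ A ∪ s
      · rwa [Finset.insert_eq_of_mem hx]
      · refine ih.tail ?_
        have hN := cast_pos_of_fin x
        refine Finset.sum_pos' (fun y _ => mul_nonneg (by positivity)
          (stabProb_nonneg hlam.le _ _)) ⟨x, Finset.mem_univ x, ?_⟩
        exact mul_pos (by positivity) (stabProb_addedState_insert_pos hlam hx)
  have := key Finset.univ
  rwa [Finset.union_eq_right.2 (Finset.subset_univ A)] at this

theorem existsUnique_isStationary (hN : 1 ≤ N) {lam : ℝ} (hlam : 0 < lam) :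
    ∃! μ : Finset (Fin N) → ℝ, IsStationary lam μ :=
  existsUnique_stationary (chainMatrix_nonneg hlam.le) (chainMatrix_row_sum hN hlam.le)
    (chainMatrix_reaches_univ hlam)

/-- A superharmonic function of the configuration which dominates `g` at the stable
configurations bounds the stationary average of `g`. -/
theorem IsStationary.sum_mul_le {lam : ℝ} (hlam : 0 ≤ lam) {μ : Finset (Fin N) → ℝ}
    (hμ : IsStationary lam μ) {F : Config N → ℝ}
    (hF : ∀ η : BddConfig N, generator lam F η.1 ≤ 0) {g : Finset (Fin N) → ℝ}
    (hg : ∀ B, g B ≤ F (sleepers B)) :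
    ∑ A, μ A * g A ≤ ∑ A, μ A * ∑ x, (1 / (N : ℝ)) * F (addedState A x).1 := by
  have hstat : ∀ B, μ B = ∑ A, μ A * chainMatrix N lam A B := fun B => (congrFun hμ.2 B).symm
  calc ∑ B, μ B * g B = ∑ A, μ A * ∑ B, chainMatrix N lam A B * g B := by
        simp only [Finset.mul_sum]
        rw [Finset.sum_comm]
        refine Finset.sum_congr rfl fun B _ => ?_
        conv_lhs => rw [hstat B, Finset.sum_mul]
        exact Finset.sum_congr rfl fun A _ => mul_assoc _ _ _
    _ ≤ _ := by
        refine Finset.sum_le_sum fun A _ => mul_le_mul_of_nonneg_left ?_ (hμ.1.1 A)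
        simp only [chainMatrix, Finset.sum_mul]
        rw [Finset.sum_comm]
        refine Finset.sum_le_sum fun x _ => ?_
        simp only [mul_assoc]
        rw [← Finset.mul_sum]
        refine mul_le_mul_of_nonneg_left ?_ (by positivity)
        refine le_trans (Finset.sum_le_sum fun B _ => ?_)
          (sum_stabProb_mul_le hlam hF (addedState A x))
        exact mul_le_mul_of_nonneg_left (hg B) (stabProb_nonneg hlam _ B)

end Generator

end ARW

namespace ARW

/-! ### Drift and increments of the balance -/

section Drift

variable {N : ℕ}

/-- The weight of a site in `balance`: with `ρ = lam / (1 + lam)` it is `ρ` for an empty site,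
`ρ - 1` for a sleeping particle and `0` for an active site. -/
noncomputable def balanceWeight (lam : ℝ) : Site → ℝ
  | Site.sleeping => -(1 / (1 + lam))
  | Site.active 0 => lam / (1 + lam)
  | Site.active (_ + 1) => 0

/-- A linear functional of the configuration which each active particle contracts at the
rate `1 / N`. At a stable configuration it is `ρ * N` minus the number of sleeping particles. -/
noncomputable def balance (lam : ℝ) (η : Config N) : ℝ := siteSum (balanceWeight lam) η

theorem balanceWeight_le {lam : ℝ} (hlam : 0 < lam) (s : Site) :
    balanceWeight lam s ≤ lam / (1 + lam) := by
  have h : 0 < lam / (1 + lam) := by positivity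
  have h' : 0 < 1 / (1 + lam) := by positivity
  rcases s with _ | _ | k <;> simp only [balanceWeight] <;> linarith

theorem le_balanceWeight {lam : ℝ} (hlam : 0 < lam) (s : Site) :
    -(1 / (1 + lam)) ≤ balanceWeight lam s := by
  have h : 0 < lam / (1 + lam) := by positivity
  have h' : 0 < 1 / (1 + lam) := by positivity
  rcases s with _ | _ | k <;> simp only [balanceWeight] <;> linarith

theorem criticalDensity_add {lam : ℝ} (hlam : 0 < lam) : lam / (1 + lam) + 1 / (1 + lam) = 1 := by
  field_simp
  ring

theorem abs_balanceWeight_le {lam : ℝ} (hlam : 0 < lam) (s : Site) :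
    |balanceWeight lam s| ≤ 1 := by
  have h1 := balanceWeight_le hlam s
  have h2 := le_balanceWeight hlam s
  have h3 := criticalDensity_add hlam
  have h4 : 0 < lam / (1 + lam) := by positivity
  have h5 : 0 < 1 / (1 + lam) := by positivity
  rw [abs_le]
  constructor <;> linarith

theorem abs_balance_le {lam : ℝ} (hlam : 0 < lam) (η : Config N) : |balance lam η| ≤ N := by
  refine (Finset.abs_sum_le_sum_abs (fun x => balanceWeight lam (η x)) Finset.univ).trans ?_
  refine (Finset.sum_le_sum fun x _ => abs_balanceWeight_le hlam (η x)).trans ?_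
  simp

theorem balanceWeight_of_active {lam : ℝ} {s : Site} (hs : s.numActive ≠ 0) :
    balanceWeight lam s = 0 := by
  rcases s with _ | _ | k <;> simp [Site.numActive] at hs
  rfl

theorem balanceWeight_arrive (lam : ℝ) (s : Site) : balanceWeight lam s.arrive = 0 := by
  rcases s with _ | k <;> rfl

/-- This cancellation singles out ρ = λ/(1+λ): a lone particle leaves weight ρ by jumping at rate 1
and weight ρ-1 by sleeping at rate λ. With company, the site stays active in both cases. -/
theorem balanceWeight_depart_add_ring (lam : ℝ) {s : Site}
    (hs : s.numActive ≠ 0) :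
    balanceWeight lam s.depart + lam * balanceWeight lam s.ring = 0 := by
  rcases s with _ | _ | _ | k <;> simp [Site.numActive] at hs
  · change lam / (1 + lam) + lam * -(1 / (1 + lam)) = 0
    ring
  · simp [Site.depart, Site.ring, balanceWeight]

theorem balanceWeight_depart_nonneg {lam : ℝ} (hlam : 0 < lam) {s : Site}
    (hs : s.numActive ≠ 0) : 0 ≤ balanceWeight lam s.depart := by
  rcases s with _ | _ | _ | k <;> simp [Site.numActive] at hs
  · change 0 ≤ lam / (1 + lam)
    positivity
  · simp [Site.depart, balanceWeight]

theorem balance_jump_some {lam : ℝ} {η : Config N} {x y : Fin N} (hx : (η x).numActive ≠ 0)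
    (hxy : y ≠ x) : balance lam (jump η x (some y)) - balance lam η =
      balanceWeight lam (η x).depart - balanceWeight lam (η y) := by
  rw [balance, siteSum_jump_some _ _ hxy, balanceWeight_of_active hx, balanceWeight_arrive,
    ← balance]
  ring

theorem balance_jump_none {lam : ℝ} {η : Config N} {x : Fin N} (hx : (η x).numActive ≠ 0) :
    balance lam (jump η x none) - balance lam η = balanceWeight lam (η x).depart := by
  rw [balance, siteSum_jump_none, balanceWeight_of_active hx, ← balance]
  ring

theorem balance_fallAsleep {lam : ℝ} {η : Config N} {x : Fin N} (hx : (η x).numActive ≠ 0) :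
    balance lam (fallAsleep η x) - balance lam η = balanceWeight lam (η x).ring := by
  rw [balance, siteSum_fallAsleep, balanceWeight_of_active hx, ← balance]
  ring

theorem abs_balance_jump_sub_le {lam : ℝ} (hlam : 0 < lam) {η : Config N} {x : Fin N}
    (hx : (η x).numActive ≠ 0) {v : Vertex N} (hv : v ≠ some x) :
    |balance lam (jump η x v) - balance lam η| ≤ 1 := by
  rcases v with _ | y
  · rw [balance_jump_none hx]
    exact abs_balanceWeight_le hlam _
  · rw [balance_jump_some hx fun h => hv (by rw [h])]
    have h0 := balanceWeight_depart_nonneg hlam hx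
    have h1 := balanceWeight_le hlam (η x).depart
    have h2 := balanceWeight_le hlam (η y)
    have h3 := le_balanceWeight hlam (η y)
    have h4 := criticalDensity_add hlam
    have h5 : 0 < 1 / (1 + lam) := by positivity
    rw [abs_le]
    constructor <;> linarith

/-- Arrivals at a uniform target erase its weight, which averages to `-balance / N`; the effects at
`x` itself cancel by `balanceWeight_depart_add_ring`. -/
theorem siteGenerator_balance (lam : ℝ) {η : Config N} {x : Fin N}
    (hx : (η x).numActive ≠ 0) :
    siteGenerator lam (balance lam) η x = -(balance lam η / N) := by
  have hN := (cast_pos_of_fin x).ne'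
  have hsum : ∑ y ∈ Finset.univ.erase x, balanceWeight lam (η y) = balance lam η := by
    rw [balance, siteSum, ← Finset.add_sum_erase _ _ (Finset.mem_univ x),
      balanceWeight_of_active hx, zero_add]
  have hcard : ((Finset.univ.erase x).card : ℝ) = N - 1 := by
    rw [Finset.card_erase_of_mem (Finset.mem_univ x), Finset.card_univ, Fintype.card_fin,
      Nat.cast_sub x.pos, Nat.cast_one]
  have hjump : ∑ y ∈ Finset.univ.erase x,
      (1 / (N : ℝ)) * (balance lam (jump η x (some y)) - balance lam η) =
      (1 / (N : ℝ)) * ((N - 1) * balanceWeight lam (η x).depart - balance lam η) := by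
    rw [← Finset.mul_sum, ← hsum, ← hcard, ← nsmul_eq_mul, ← Finset.sum_const,
      ← Finset.sum_sub_distrib, hsum]
    congr 1
    exact Finset.sum_congr rfl fun y hy => balance_jump_some hx (Finset.ne_of_mem_erase hy)
  rw [siteGenerator, sum_erase_some, hjump, balance_jump_none hx, balance_fallAsleep hx]
  have := balanceWeight_depart_add_ring lam hx
  field_simp
  linear_combination (N : ℝ) * this

/-- Second-order expansion: exp u ≤ 1 + u + u² for |u| ≤ 1, with u² ≤ 4c² and total event rate 1 +
λ. -/
theorem siteGenerator_exp_le {lam : ℝ} (hlam : 0 ≤ lam) {W : Config N → ℝ} {η : Config N}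
    {x : Fin N} (hjump : ∀ v, v ≠ some x → |W (jump η x v) - W η| ≤ 2)
    (hsleep : |W (fallAsleep η x) - W η| ≤ 2) {c : ℝ} (hc : |c| ≤ 1 / 2) :
    siteGenerator lam (fun η => Real.exp (c * W η)) η x ≤
      Real.exp (c * W η) * (c * siteGenerator lam W η x + 4 * c ^ 2 * (1 + lam)) := by
  have hN := (cast_pos_of_fin x).ne'
  have key : ∀ w : ℝ, |w - W η| ≤ 2 → Real.exp (c * w) - Real.exp (c * W η) ≤
      Real.exp (c * W η) * (c * (w - W η) + 4 * c ^ 2) := by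
    intro w hw
    have h1 : |c * (w - W η)| ≤ 1 := by
      rw [abs_mul]
      nlinarith [abs_nonneg c, abs_nonneg (w - W η)]
    have h2 := (abs_le.1 (Real.abs_exp_sub_one_sub_id_le h1)).2
    have h3 : (w - W η) ^ 2 ≤ 4 := by
      rw [← sq_abs]; nlinarith [abs_nonneg (w - W η)]
    have h4 : (c * (w - W η)) ^ 2 ≤ 4 * c ^ 2 := by
      rw [mul_pow]; nlinarith [sq_nonneg c]
    have h5 : Real.exp (c * w) = Real.exp (c * W η) * Real.exp (c * (w - W η)) := by
      rw [← Real.exp_add]; ring_nf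
    rw [h5]
    nlinarith [Real.exp_pos (c * W η)]
  have hcard : (((Finset.univ : Finset (Vertex N)).erase (some x)).card : ℝ) = N := by
    rw [Finset.card_erase_of_mem (Finset.mem_univ _), Finset.card_univ, Fintype.card_option,
      Fintype.card_fin, Nat.add_sub_cancel]
  have h1 : ∑ v ∈ (Finset.univ : Finset (Vertex N)).erase (some x),
      (1 / (N : ℝ)) * (Real.exp (c * W (jump η x v)) - Real.exp (c * W η)) ≤
      Real.exp (c * W η) * (c * (∑ v ∈ (Finset.univ : Finset (Vertex N)).erase (some x),
        (1 / (N : ℝ)) * (W (jump η x v) - W η)) + 4 * c ^ 2) := by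
    have hc2 : 4 * c ^ 2 = ∑ v ∈ (Finset.univ : Finset (Vertex N)).erase (some x),
        (1 / (N : ℝ)) * (4 * c ^ 2) := by
      rw [Finset.sum_const, nsmul_eq_mul, hcard]
      field_simp
    rw [hc2, Finset.mul_sum, ← Finset.sum_add_distrib, Finset.mul_sum]
    refine Finset.sum_le_sum fun v hv => ?_
    have := mul_le_mul_of_nonneg_left (key _ (hjump v (Finset.ne_of_mem_erase hv)))
      (by positivity : (0 : ℝ) ≤ 1 / N)
    refine this.trans (le_of_eq ?_)
    ring
  have h2 := mul_le_mul_of_nonneg_left (key _ hsleep) hlam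
  simp only [siteGenerator]
  refine (add_le_add h1 h2).trans (le_of_eq ?_)
  ring

theorem balance_sleepers {lam : ℝ} (hlam : 0 < lam) (A : Finset (Fin N)) :
    balance lam (sleepers A) = lam / (1 + lam) * N - A.card := by
  have h : ∀ x, balanceWeight lam (sleepers A x) =
      lam / (1 + lam) - if x ∈ A then 1 else 0 := by
    intro x
    by_cases hx : x ∈ A
    · simp only [sleepers, hx, if_true, balanceWeight]
      linarith [criticalDensity_add hlam]
    · simp [sleepers, hx, balanceWeight]
  simp [balance, siteSum, h, Finset.sum_sub_distrib, mul_comm]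

theorem balance_addedState (lam : ℝ) (A : Finset (Fin N)) (x : Fin N) :
    balance lam (addedState A x).1 =
      balance lam (sleepers A) - balanceWeight lam (sleepers A x) := by
  simp only [addedState, arriveAt]
  rw [balance, siteSum_update, balanceWeight_arrive, ← balance]
  ring

theorem particleCount_addedState (A : Finset (Fin N)) (x : Fin N) :
    particleCount (addedState A x).1 = A.card + 1 := by
  simp only [addedState]
  rw [particleCount_arriveAt, particleCount_sleepers]

end Drift

/-! ### Exponential moment of the balance: not too few sleepers -/

section Concentration

variable {N : ℕ}

theorem generator_exp_balance_add_nonpos {lam : ℝ} (hlam : 0 < lam) {θ β : ℝ} (hθ : 0 < θ)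
    (hθ' : θ ≤ 1 / 2) (hβ : 16 * θ * N * (1 + lam) = β) (η : Config N) :
    generator lam (fun η => Real.exp (θ * balance lam η) +
      Real.exp (θ * β) * (2 + lam) * (N * particleCount η)) η ≤ 0 := by
  refine generator_nonpos fun x hx => ?_
  have hN := cast_pos_of_fin x
  rw [siteGenerator_add lam (fun η => Real.exp (θ * balance lam η)), siteGenerator_const_mul,
    siteGenerator_mul_particleCount lam hx]
  have h1 := siteGenerator_exp_le hlam.le (W := balance lam)
    (fun v hv => (abs_balance_jump_sub_le hlam hx hv).trans one_le_two)
    (by rw [balance_fallAsleep hx]; exact (abs_balanceWeight_le hlam _).trans one_le_two)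
    (abs_le.2 ⟨by linarith, hθ'⟩ : |θ| ≤ 1 / 2)
  rw [siteGenerator_balance lam hx] at h1
  set Z := balance lam η
  have hpos : 0 < Real.exp (θ * β) * (2 + lam) := by positivity
  -- Above β the drift term is at most -16θ²(1+λ) and beats the error 4θ²(1+λ). Below β the crude
  -- bound `|Z| ≤ N` leaves at most exp(θβ)(2+λ), exactly what the count term returns.
  rcases le_or_gt β Z with hZ | hZ
  · have h2 : β / N ≤ Z / N := div_le_div_of_nonneg_right hZ hN.le
    have h3 : β / N = 16 * θ * (1 + lam) := by rw [← hβ]; field_simp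
    have h4 : θ * -(Z / N) + 4 * θ ^ 2 * (1 + lam) ≤ 0 := by
      have : 0 < θ * (1 + lam) := by positivity
      nlinarith
    have h5 := mul_nonpos_of_nonneg_of_nonpos (Real.exp_pos (θ * Z)).le h4
    linarith
  · have h2 : -(Z / N) ≤ 1 := by
      rw [← neg_div, div_le_one hN]
      exact (neg_le_abs Z).trans (abs_balance_le hlam η)
    have hsq : θ ^ 2 * (1 + lam) ≤ 1 / 4 * (1 + lam) :=
      mul_le_mul_of_nonneg_right (by nlinarith) (by positivity)
    have h3 : θ * -(Z / N) + 4 * θ ^ 2 * (1 + lam) ≤ 2 + lam := by nlinarith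
    have h4 : Real.exp (θ * Z) ≤ Real.exp (θ * β) :=
      Real.exp_le_exp.2 (mul_le_mul_of_nonneg_left hZ.le hθ.le)
    have h5 := mul_le_mul_of_nonneg_left h3 (Real.exp_pos (θ * Z)).le
    have h6 := mul_le_mul_of_nonneg_right h4 (by positivity : 0 ≤ 2 + lam)
    linarith

/-- Stabilisation alone gives no strict contraction; the addition step does. The new particle resets
the weight of a uniform vertex, so Z again changes by -Z/N on average, with quadratic error θ². -/
theorem sum_exp_balance_addedState_le {lam : ℝ} (hlam : 0 < lam) (hN : 1 ≤ N) {θ β : ℝ}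
    (hθ : 0 < θ) (hθ' : θ ≤ 1 / 2) (hβ : 16 * θ * N * (1 + lam) = β) (A : Finset (Fin N)) :
    ∑ x, (1 / (N : ℝ)) * Real.exp (θ * balance lam (addedState A x).1) ≤
      (1 - θ * β / (2 * N)) * Real.exp (θ * balance lam (sleepers A)) +
        Real.exp (θ * β) * (2 + lam) * 2 := by
  have hN' : (0 : ℝ) < N := by positivity
  set Z := balance lam (sleepers A) with hZdef
  have hterm : ∀ x, Real.exp (θ * balance lam (addedState A x).1) ≤
      Real.exp (θ * Z) * (1 - θ * balanceWeight lam (sleepers A x) + θ ^ 2) := by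
    intro x
    set w := balanceWeight lam (sleepers A x) with hw
    have hw1 : |w| ≤ 1 := abs_balanceWeight_le hlam _
    rw [balance_addedState, ← hw, ← hZdef,
      show θ * (Z - w) = θ * Z + -(θ * w) by ring, Real.exp_add]
    refine mul_le_mul_of_nonneg_left ?_ (Real.exp_pos _).le
    have h1 : |-(θ * w)| ≤ 1 := by
      rw [abs_neg, abs_mul, abs_of_pos hθ]; nlinarith [abs_nonneg w]
    have h2 := (abs_le.1 (Real.abs_exp_sub_one_sub_id_le h1)).2
    have h3 : w ^ 2 ≤ 1 := by rw [← sq_abs]; nlinarith [abs_nonneg w]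
    nlinarith [sq_nonneg θ]
  have hsum : ∑ x, (1 / (N : ℝ)) * (Real.exp (θ * Z) *
      (1 - θ * balanceWeight lam (sleepers A x) + θ ^ 2)) =
      Real.exp (θ * Z) * (1 - θ * (Z / N) + θ ^ 2) := by
    rw [← Finset.mul_sum, ← Finset.mul_sum, Finset.sum_add_distrib, Finset.sum_sub_distrib,
      ← Finset.mul_sum]
    have : ∑ x, balanceWeight lam (sleepers A x) = Z := rfl
    rw [this]
    simp only [Finset.sum_const, Finset.card_univ, Fintype.card_fin, nsmul_eq_mul]
    field_simp
  have hβN : β / N = 16 * θ * (1 + lam) := by rw [← hβ]; field_simp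
  have hκ : θ * β / (2 * N) = 8 * θ ^ 2 * (1 + lam) := by
    rw [mul_div_mul_comm, hβN]; ring
  refine (Finset.sum_le_sum fun x _ =>
    mul_le_mul_of_nonneg_left (hterm x) (by positivity)).trans ?_
  rw [hsum, hκ]
  have hpos : 0 < Real.exp (θ * β) * (2 + lam) * 2 := by positivity
  rcases le_or_gt β Z with hZ | hZ
  · have h2 : β / N ≤ Z / N := div_le_div_of_nonneg_right hZ hN'.le
    have h3 : θ * (16 * θ * (1 + lam)) ≤ θ * (Z / N) :=
      mul_le_mul_of_nonneg_left (hβN ▸ h2) hθ.le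
    have h4 : 1 - θ * (Z / N) + θ ^ 2 ≤ 1 - 8 * θ ^ 2 * (1 + lam) := by
      have : 0 < θ ^ 2 * lam := by positivity
      nlinarith [sq_nonneg θ]
    have h5 := mul_le_mul_of_nonneg_left h4 (Real.exp_pos (θ * Z)).le
    linarith
  · have h2 : -(Z / N) ≤ 1 := by
      rw [← neg_div, div_le_one hN']
      exact (neg_le_abs Z).trans (abs_balance_le hlam _)
    have hsq : θ ^ 2 ≤ 1 / 4 := by nlinarith
    have h3 : -(θ * (Z / N)) + θ ^ 2 + 8 * θ ^ 2 * (1 + lam) ≤ (2 + lam) * 2 := by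
      have h7 : θ ^ 2 * (1 + lam) ≤ 1 / 4 * (1 + lam) :=
        mul_le_mul_of_nonneg_right hsq (by positivity)
      nlinarith
    have h4 : Real.exp (θ * Z) ≤ Real.exp (θ * β) :=
      Real.exp_le_exp.2 (mul_le_mul_of_nonneg_left hZ.le hθ.le)
    have h5 := mul_le_mul_of_nonneg_left h3 (Real.exp_pos (θ * Z)).le
    have h6 := mul_le_mul_of_nonneg_right h4 (by positivity : 0 ≤ (2 + lam) * 2)
    linarith

/-- Under stationarity the mean of the exponential is the same on both sides of the one-step
inequality, so the contraction gap times that mean is at most the additive error. -/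
theorem IsStationary.sum_exp_le {lam : ℝ} (hlam : 0 < lam) (hN : 1 ≤ N)
    {μ : Finset (Fin N) → ℝ} (hμ : IsStationary lam μ) {θ β : ℝ}
    (hθ : 0 < θ) (hθ' : θ ≤ 1 / 2) (hβ : 16 * θ * N * (1 + lam) = β) :
    θ * β / (2 * N) * ∑ A, μ A * Real.exp (θ * (lam / (1 + lam) * N - A.card)) ≤
      Real.exp (θ * β) * (2 + lam) * (N * (N + 1) + 2) := by
  have hN' : (0 : ℝ) < N := by positivity
  set D := Real.exp (θ * β) * (2 + lam) with hD
  have hD0 : 0 < D := by positivity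
  have hmain := hμ.sum_mul_le hlam.le
    (F := fun η => Real.exp (θ * balance lam η) + D * (N * particleCount η))
    (g := fun A => Real.exp (θ * balance lam (sleepers A)))
    (fun η => generator_exp_balance_add_nonpos hlam hθ hθ' hβ η.1)
    (fun B => le_add_of_nonneg_right (by positivity))
  have hstep : ∀ A : Finset (Fin N), ∑ x, (1 / (N : ℝ)) *
      (Real.exp (θ * balance lam (addedState A x).1) +
        D * (N * particleCount (addedState A x).1)) ≤
      (1 - θ * β / (2 * N)) * Real.exp (θ * balance lam (sleepers A)) +
        D * (N * (N + 1) + 2) := by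
    intro A
    simp only [mul_add, Finset.sum_add_distrib]
    have h1 := sum_exp_balance_addedState_le hlam hN hθ hθ' hβ A
    rw [← hD] at h1
    have hcard : (A.card : ℝ) ≤ N := by
      have := Finset.card_le_univ A
      rw [Fintype.card_fin] at this
      exact_mod_cast this
    have h2 : ∑ x : Fin N, (1 / (N : ℝ)) * (D * (N * particleCount (addedState A x).1)) ≤
        D * (N * (N + 1)) := by
      simp only [particleCount_addedState, Finset.sum_const, Finset.card_univ,
        Fintype.card_fin, nsmul_eq_mul]
      rw [← mul_assoc (N : ℝ), mul_one_div_cancel hN'.ne', one_mul]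
      push_cast
      gcongr
    linarith
  have h3 := hmain.trans (Finset.sum_le_sum fun A _ =>
    mul_le_mul_of_nonneg_left (hstep A) (hμ.1.1 A))
  simp only [mul_add (μ _), Finset.sum_add_distrib, ← Finset.sum_mul, hμ.1.2, one_mul] at h3
  have h4 : ∑ A, μ A * ((1 - θ * β / (2 * N)) * Real.exp (θ * balance lam (sleepers A))) =
      (1 - θ * β / (2 * N)) * ∑ A, μ A * Real.exp (θ * balance lam (sleepers A)) := by
    rw [Finset.mul_sum]
    exact Finset.sum_congr rfl fun A _ => by ring
  rw [h4] at h3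
  simp only [balance_sleepers hlam] at h3
  linarith

/-! ### Mean excess of particles: not too many sleepers -/

/-- Up to the weights, the number of active particles. -/
noncomputable def activity (lam : ℝ) (η : Config N) : ℝ :=
  balance lam η + (particleCount η + -(lam / (1 + lam) * N))

theorem siteGenerator_activity (lam : ℝ) {η : Config N} {x : Fin N}
    (hx : (η x).numActive ≠ 0) :
    siteGenerator lam (activity lam) η x = -((balance lam η + 1) / N) := by
  have h := siteGenerator_add lam (balance lam)
    (fun η => (particleCount η : ℝ) + -(lam / (1 + lam) * N)) η x
  rw [siteGenerator_add lam (fun η => (particleCount η : ℝ)) (fun _ => -(lam / (1 + lam) * N)),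
    siteGenerator_balance lam hx, siteGenerator_particleCount lam hx] at h
  have h0 : siteGenerator lam (fun _ : Config N => -(lam / (1 + lam) * N)) η x = 0 := by
    simp [siteGenerator]
  rw [h0] at h
  exact h.trans (by ring)

theorem abs_activity_jump_sub_le {lam : ℝ} (hlam : 0 < lam) {η : Config N} {x : Fin N}
    (hx : (η x).numActive ≠ 0) {v : Vertex N} (hv : v ≠ some x) :
    |activity lam (jump η x v) - activity lam η| ≤ 2 := by
  have h1 := abs_le.1 (abs_balance_jump_sub_le hlam hx hv)
  have h2 : (particleCount (jump η x v) : ℝ) ≤ particleCount η := by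
    exact_mod_cast particleCount_jump_le hx hv
  have h3 : (particleCount η : ℝ) ≤ particleCount (jump η x v) + 1 := by
    rcases v with _ | y
    · exact_mod_cast (particleCount_jump_none hx).ge
    · have := particleCount_jump_some hx (y := y) fun h => hv (by rw [h])
      rw [this]; linarith
  simp only [activity]
  rw [abs_le]
  constructor <;> linarith [h1.1, h1.2]

theorem abs_activity_fallAsleep_sub_le {lam : ℝ} (hlam : 0 < lam) {η : Config N} {x : Fin N}
    (hx : (η x).numActive ≠ 0) : |activity lam (fallAsleep η x) - activity lam η| ≤ 2 := by
  have h1 := abs_balanceWeight_le hlam (η x).ring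
  rw [← balance_fallAsleep hx] at h1
  simp only [activity, particleCount_fallAsleep]
  rw [add_sub_add_right_eq_sub]
  exact h1.trans one_le_two

theorem siteGenerator_exp_activity_add_nonpos {lam : ℝ} (hlam : 0 < lam) {θ β : ℝ} (hθ : 0 < θ)
    (hθ' : θ ≤ 1 / 2) (hβ : 16 * θ * N * (1 + lam) = β) (hβ4 : 4 ≤ β) {η : Config N}
    {x : Fin N} (hx : (η x).numActive ≠ 0)
    (hη : lam / (1 + lam) * N + β ≤ particleCount η) :
    siteGenerator lam (fun η => Real.exp (-θ * activity lam η) +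
      Real.exp (-(θ * β / 2)) * (2 + lam) * (N * particleCount η)) η x ≤ 0 := by
  have hN := cast_pos_of_fin x
  rw [siteGenerator_add lam (fun η => Real.exp (-θ * activity lam η)), siteGenerator_const_mul,
    siteGenerator_mul_particleCount lam hx]
  have h1 := siteGenerator_exp_le hlam.le (W := activity lam)
    (fun v hv => abs_activity_jump_sub_le hlam hx hv) (abs_activity_fallAsleep_sub_le hlam hx)
    (by rw [abs_neg, abs_of_pos hθ]; exact hθ' : |-θ| ≤ 1 / 2)
  rw [siteGenerator_activity lam hx] at h1
  have hβN : β / N = 16 * θ * (1 + lam) := by rw [← hβ]; field_simp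
  have hpos : 0 < Real.exp (-(θ * β / 2)) * (2 + lam) := by positivity
  set Z := balance lam η with hZ
  have hact : activity lam η = Z + (particleCount η + -(lam / (1 + lam) * N)) := rfl
  -- Low activity with at least ρN + β particles forces `Z ≤ -β/2`; then `Z + 1 ≤ -β/4` because `β ≥
  -- 4`, and the resulting drift exactly matches the quadratic error. High activity makes the
  -- exponential itself tiny.
  rcases le_or_gt (activity lam η) (β / 2) with hy | hy
  · have h2 : (Z + 1) / N ≤ -(β / 4) / N := by
      refine div_le_div_of_nonneg_right ?_ hN.le
      linarith
    have h3 : -(β / 4) / N = -(4 * θ * (1 + lam)) := by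
      rw [neg_div, div_right_comm, hβN]; ring
    have h4 : -θ * -((Z + 1) / N) + 4 * (-θ) ^ 2 * (1 + lam) ≤ 0 := by
      rw [h3] at h2
      nlinarith
    have h5 := mul_nonpos_of_nonneg_of_nonpos (Real.exp_pos (-θ * activity lam η)).le h4
    linarith
  · have h2 : (Z + 1) / N ≤ 2 := by
      rw [div_le_iff₀ hN]
      have h3 := (le_abs_self Z).trans (abs_balance_le hlam η)
      have h4 : (1 : ℝ) ≤ N := by exact_mod_cast x.pos
      linarith
    have hsq : θ ^ 2 ≤ 1 / 4 := by nlinarith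
    have h3 : -θ * -((Z + 1) / N) + 4 * (-θ) ^ 2 * (1 + lam) ≤ 2 + lam := by
      have h7 : θ ^ 2 * (1 + lam) ≤ 1 / 4 * (1 + lam) :=
        mul_le_mul_of_nonneg_right hsq (by positivity)
      nlinarith
    have h4 : Real.exp (-θ * activity lam η) ≤ Real.exp (-(θ * β / 2)) := by
      refine Real.exp_le_exp.2 ?_
      nlinarith
    have h5 := mul_le_mul_of_nonneg_left h3 (Real.exp_pos (-θ * activity lam η)).le
    have h6 := mul_le_mul_of_nonneg_right h4 (by positivity : 0 ≤ 2 + lam)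
    linarith

theorem siteGenerator_mul_le {lam : ℝ} (hlam : 0 ≤ lam) {m f : Config N → ℝ} {η : Config N}
    {x : Fin N} (hf : ∀ ξ, 0 ≤ f ξ) (hjump : ∀ v, v ≠ some x → m (jump η x v) ≤ m η)
    (hsleep : m (fallAsleep η x) ≤ m η) :
    siteGenerator lam (fun η => m η * f η) η x ≤ m η * siteGenerator lam f η x := by
  simp only [siteGenerator, mul_add, Finset.mul_sum]
  refine add_le_add (Finset.sum_le_sum fun v hv => ?_) ?_
  · have h := mul_le_mul_of_nonneg_right (hjump v (Finset.ne_of_mem_erase hv)) (hf (jump η x v))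
    calc _ ≤ 1 / (N : ℝ) * (m η * f (jump η x v) - m η * f η) := by gcongr
      _ = _ := by ring
  · have h := mul_le_mul_of_nonneg_right hsleep (hf (fallAsleep η x))
    calc _ ≤ lam * (m η * f (fallAsleep η x) - m η * f η) := by gcongr
      _ = _ := by ring

/-- Below the threshold, where the second factor is not controlled, the excess is 0 and cannot
become positive; above it, `siteGenerator_mul_le` lets the nonincreasing excess be treated as a
constant. -/
theorem generator_excess_mul_nonpos {lam : ℝ} (hlam : 0 < lam) {θ β : ℝ} (hθ : 0 < θ)
    (hθ' : θ ≤ 1 / 2) (hβ : 16 * θ * N * (1 + lam) = β) (hβ4 : 4 ≤ β) (η : Config N) :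
    generator lam (fun η => max ((particleCount η : ℝ) - (lam / (1 + lam) * N + β)) 0 *
      (Real.exp (-θ * activity lam η) +
      Real.exp (-(θ * β / 2)) * (2 + lam) * (N * particleCount η))) η ≤ 0 := by
  refine generator_nonpos fun x hx => ?_
  refine (siteGenerator_mul_le hlam.le (fun ξ => by positivity) (fun v hv => ?_) ?_).trans ?_
  · have : (particleCount (jump η x v) : ℝ) ≤ particleCount η := by
      exact_mod_cast particleCount_jump_le hx hv
    gcongr
  · rw [particleCount_fallAsleep]
  · rcases le_or_gt (lam / (1 + lam) * N + β) (particleCount η) with h | h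
    · exact mul_nonpos_of_nonneg_of_nonpos (le_max_right _ _)
        (siteGenerator_exp_activity_add_nonpos hlam hθ hθ' hβ hβ4 hx h)
    · rw [max_eq_right (by linarith), zero_mul]

/-- Stabilising with a large count requires `activity` to fall to 0 against its drift, which the
last factor penalises. When that factor is below 1, the inequality bounds the mean excess. -/
theorem IsStationary.sum_excess_le {lam : ℝ} (hlam : 0 < lam) (hN : 1 ≤ N)
    {μ : Finset (Fin N) → ℝ} (hμ : IsStationary lam μ) {θ β : ℝ}
    (hθ : 0 < θ) (hθ' : θ ≤ 1 / 2) (hβ : 16 * θ * N * (1 + lam) = β) (hβ4 : 4 ≤ β) :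
    ∑ A, μ A * max ((A.card : ℝ) - (lam / (1 + lam) * N + β)) 0 ≤
      (∑ A, μ A * max ((A.card : ℝ) - (lam / (1 + lam) * N + β)) 0 + 1) *
        (Real.exp (-θ * (1 / (1 + lam))) +
          Real.exp (-(θ * β / 2)) * (2 + lam) * (N * (N + 1))) := by
  have hN' : (0 : ℝ) < N := by positivity
  set D := Real.exp (-(θ * β / 2)) * (2 + lam) with hD
  have hD0 : 0 < D := by positivity
  set r := Real.exp (-θ * (1 / (1 + lam))) + D * (N * (N + 1)) with hr
  have hr0 : 0 < r := by positivity
  set c := lam / (1 + lam) * N + β with hc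
  have hmain := hμ.sum_mul_le hlam.le
    (F := fun η => max ((particleCount η : ℝ) - c) 0 *
      (Real.exp (-θ * activity lam η) + D * (N * particleCount η)))
    (g := fun A => max ((A.card : ℝ) - c) 0)
    (fun η => generator_excess_mul_nonpos hlam hθ hθ' hβ hβ4 η.1)
    (fun B => by
      have h0 : activity lam (sleepers B) = 0 := by
        rw [activity, balance_sleepers hlam, particleCount_sleepers]; ring
      rw [h0, mul_zero, Real.exp_zero, particleCount_sleepers]
      refine le_mul_of_one_le_right (le_max_right _ _) ?_
      have : 0 ≤ D * (N * (B.card : ℝ)) := by positivity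
      linarith)
  refine hmain.trans ?_
  have hstep : ∀ A : Finset (Fin N), ∑ x, (1 / (N : ℝ)) *
      (max ((particleCount (addedState A x).1 : ℝ) - c) 0 *
      (Real.exp (-θ * activity lam (addedState A x).1) +
        D * (N * particleCount (addedState A x).1))) ≤
      (max ((A.card : ℝ) - c) 0 + 1) * r := by
    intro A
    have hcard : (A.card : ℝ) ≤ N := by
      have := Finset.card_le_univ A
      rw [Fintype.card_fin] at this
      exact_mod_cast this
    have hx : ∀ x ∈ Finset.univ, (1 / (N : ℝ)) *
        (max ((particleCount (addedState A x).1 : ℝ) - c) 0 *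
        (Real.exp (-θ * activity lam (addedState A x).1) +
          D * (N * particleCount (addedState A x).1))) ≤
        (1 / (N : ℝ)) * ((max ((A.card : ℝ) - c) 0 + 1) * r) := by
      intro x _
      -- The addition raises the count by 1 and removes a weight of at most ρ, so activity rises
      -- from 0 to at least 1-ρ.
      have hact : 1 / (1 + lam) ≤ activity lam (addedState A x).1 := by
        rw [activity, balance_addedState, balance_sleepers hlam, particleCount_addedState]
        have h1 := balanceWeight_le hlam (sleepers A x)
        have h2 := criticalDensity_add hlam
        push_cast
        linarith
      have h1 : Real.exp (-θ * activity lam (addedState A x).1) ≤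
          Real.exp (-θ * (1 / (1 + lam))) :=
        Real.exp_le_exp.2 (mul_le_mul_of_nonpos_left hact (by linarith))
      rw [particleCount_addedState]
      push_cast
      have h2 : max ((A.card : ℝ) + 1 - c) 0 ≤ max ((A.card : ℝ) - c) 0 + 1 := by
        refine max_le ?_ ?_
        · linarith [le_max_left ((A.card : ℝ) - c) 0]
        · linarith [le_max_right ((A.card : ℝ) - c) 0]
      rw [hr]
      gcongr
    refine (Finset.sum_le_sum hx).trans (le_of_eq ?_)
    rw [Finset.sum_const, Finset.card_univ, Fintype.card_fin, nsmul_eq_mul]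
    field_simp
  refine (Finset.sum_le_sum fun A _ =>
    mul_le_mul_of_nonneg_left (hstep A) (hμ.1.1 A)).trans (le_of_eq ?_)
  simp only [← mul_assoc, ← Finset.sum_mul, mul_add, mul_one, Finset.sum_add_distrib, hμ.1.2]

end Concentration

end ARW

namespace ARW

/-! ### Tail bounds and choice of parameters -/

section CountProb

variable {N : ℕ}

theorem countProb_le_one {μ : Finset (Fin N) → ℝ} (hμ : μ ∈ stdSimplex ℝ (Finset (Fin N)))
    (a b : ℝ) : countProb μ a b ≤ 1 := by
  rw [← hμ.2]
  exact Finset.sum_le_sum fun A _ => Set.indicator_le_self' (fun A _ => hμ.1 A) A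

/-- Chernoff below and Markov above. The window has half-width 2β because the excess is measured
from `c + β`, so an overshoot has excess more than β. -/
theorem one_sub_countProb_le {μ : Finset (Fin N) → ℝ}
    (hμ : μ ∈ stdSimplex ℝ (Finset (Fin N))) (c : ℝ) {θ β : ℝ} (hθ : 0 < θ) (hβ : 0 < β) :
    1 - countProb μ (c - 2 * β) (c + 2 * β) ≤
      Real.exp (-(2 * (θ * β))) * ∑ A, μ A * Real.exp (θ * (c - A.card)) +
        (∑ A, μ A * max ((A.card : ℝ) - (c + β)) 0) / β := by
  rw [← hμ.2, countProb, ← Finset.sum_sub_distrib, Finset.mul_sum, Finset.sum_div,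
    ← Finset.sum_add_distrib]
  refine Finset.sum_le_sum fun A _ => ?_
  have hA := hμ.1 A
  have h1 : 0 ≤ Real.exp (-(2 * (θ * β))) * (μ A * Real.exp (θ * (c - A.card))) := by positivity
  have h2 : 0 ≤ μ A * max ((A.card : ℝ) - (c + β)) 0 / β := by positivity
  by_cases hmem : A ∈ {A : Finset (Fin N) | (A.card : ℝ) ∈ Set.Icc (c - 2 * β) (c + 2 * β)}
  · rw [Set.indicator_of_mem hmem, sub_self]
    exact add_nonneg h1 h2
  · rw [Set.indicator_of_notMem hmem, sub_zero]
    rw [Set.mem_ofPred_eq, Set.mem_Icc, not_and_or, not_le, not_le] at hmem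
    rcases hmem with h | h
    · have h3 : 1 ≤ Real.exp (-(2 * (θ * β))) * Real.exp (θ * (c - A.card)) := by
        rw [← Real.exp_add]
        refine Real.one_le_exp ?_
        nlinarith
      have h4 := mul_le_mul_of_nonneg_left h3 hA
      linarith
    · have h3 : 1 ≤ max ((A.card : ℝ) - (c + β)) 0 / β := by
        rw [one_le_div hβ]
        exact le_max_of_le_left (by linarith)
      have h4 := mul_le_mul_of_nonneg_left h3 hA
      rw [← mul_div_assoc] at h4
      linarith

theorem IsStationary.one_sub_countProb_le {lam : ℝ} (hlam : 0 < lam) (hN : 1 ≤ N)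
    {μ : Finset (Fin N) → ℝ} (hμ : IsStationary lam μ) {θ β : ℝ}
    (hθ : 0 < θ) (hθ' : θ ≤ 1 / 2) (hβ : 16 * θ * N * (1 + lam) = β) (hβ4 : 4 ≤ β)
    (hsmall : Real.exp (-(θ * β / 2)) * (2 + lam) * (N * (N + 1)) ≤ θ / (4 * (1 + lam))) :
    1 - countProb μ (lam / (1 + lam) * N - 2 * β) (lam / (1 + lam) * N + 2 * β) ≤
      Real.exp (-(θ * β)) * (2 + lam) * (N * (N + 1) + 2) * (2 * N) / (θ * β) +
        4 * (1 + lam) / (θ * β) := by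
  have hN' : (0 : ℝ) < N := by positivity
  have hβ0 : 0 < β := by linarith
  refine (ARW.one_sub_countProb_le hμ.1 _ hθ hβ0).trans (add_le_add ?_ ?_)
  · have h := hμ.sum_exp_le hlam hN hθ hθ' hβ
    set S := ∑ A, μ A * Real.exp (θ * (lam / (1 + lam) * N - A.card))
    rw [div_mul_eq_mul_div, div_le_iff₀ (by positivity)] at h
    rw [le_div_iff₀ (by positivity)]
    have h1 : Real.exp (-(2 * (θ * β))) * Real.exp (θ * β) = Real.exp (-(θ * β)) := by
      rw [← Real.exp_add]; ring_nf
    have h2 := mul_le_mul_of_nonneg_left h (Real.exp_pos (-(2 * (θ * β)))).le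
    rw [← h1]
    linarith
  · have h := hμ.sum_excess_le hlam hN hθ hθ' hβ hβ4
    set S := ∑ A, μ A * max ((A.card : ℝ) - (lam / (1 + lam) * N + β)) 0
    have hS : 0 ≤ S := Finset.sum_nonneg fun A _ => mul_nonneg (hμ.1.1 A) (le_max_right _ _)
    set t := θ / (1 + lam) with ht
    have ht0 : 0 < t := by positivity
    have ht1 : t ≤ 1 / 2 := (div_le_self hθ.le (by linarith)).trans hθ'
    have hexp : Real.exp (-θ * (1 / (1 + lam))) ≤ 1 - t / 2 := by
      rw [show -θ * (1 / (1 + lam)) = -t by rw [ht]; ring]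
      have h1 := (abs_le.1 (Real.abs_exp_sub_one_sub_id_le
        (by rw [abs_neg, abs_of_pos ht0]; linarith : |-t| ≤ 1))).2
      nlinarith
    have hq : θ / (4 * (1 + lam)) = t / 4 := by rw [ht]; field_simp
    rw [hq] at hsmall
    have hS2 : S ≤ (S + 1) * (1 - t / 4) :=
      h.trans (mul_le_mul_of_nonneg_left (by linarith) (by linarith))
    -- The one-step factor loses t/2 from the exponential and regains at most t/4 from the
    -- correction.
    have hS3 : S * (t / 4) ≤ 1 := by nlinarith
    have h4 : 4 * (1 + lam) / (θ * β) = 4 / t / β := by rw [ht]; field_simp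
    rw [h4]
    refine div_le_div_of_nonneg_right ?_ hβ0.le
    rw [le_div_iff₀ ht0]
    linarith

theorem two_mul_log_le (hN : 1 ≤ N) : 2 * Real.log N ≤ N := by
  have hN' : (0 : ℝ) < N := by positivity
  have h : Real.log N ≤ N / 2 := by
    rw [Real.log_le_iff_le_exp hN']
    refine le_trans ?_ (Real.quadratic_le_exp_of_nonneg (by positivity : (0 : ℝ) ≤ N / 2))
    nlinarith [sq_nonneg ((N : ℝ) - 2)]
  linarith

theorem IsStationary.one_sub_countProb_le_div_log {lam : ℝ} (hlam : 0 < lam) (hN : 3 ≤ N)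
    (hlarge : 32 * (2 + lam) * (1 + lam) ^ 2 ≤ N) {μ : Finset (Fin N) → ℝ}
    (hμ : IsStationary lam μ) {β : ℝ}
    (hβ : β = Real.sqrt (128 * (1 + lam)) * Real.sqrt (N * Real.log N)) :
    1 - countProb μ (lam / (1 + lam) * N - 2 * β) (lam / (1 + lam) * N + 2 * β) ≤
      (3 + 2 * lam) / Real.log N := by
  have hN3 : (3 : ℝ) ≤ N := by exact_mod_cast hN
  have hN' : (0 : ℝ) < N := by linarith
  set L := Real.log N with hL
  have hL1 : 1 ≤ L := by
    rw [hL, Real.le_log_iff_exp_le hN']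
    linarith [Real.exp_one_lt_three]
  have hβ2 : β ^ 2 = 128 * (1 + lam) * (N * L) := by
    rw [hβ, mul_pow, Real.sq_sqrt (by positivity), Real.sq_sqrt (by positivity)]
  have hβ0 : 0 ≤ β := by rw [hβ]; positivity
  have hNL : 3 ≤ N * L := by nlinarith
  have hβ4 : 4 ≤ β := by
    refine (sq_le_sq₀ (by norm_num) hβ0).1 ?_
    rw [hβ2]
    nlinarith
  -- Then θβ = β²/(16N(1+λ)), and the constant 128 in β makes this 8 log N, so the exponential
  -- factors become powers N⁻⁸ and N⁻⁴.
  set θ := β / (16 * N * (1 + lam)) with hθ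
  have hθ0 : 0 < θ := by positivity
  have hθβ : θ * β = 8 * L := by
    rw [hθ, div_mul_eq_mul_div, ← sq, hβ2]
    field_simp
    norm_num
  have hβθ : 16 * θ * N * (1 + lam) = β := by rw [hθ]; field_simp
  have hθ' : θ ≤ 1 / 2 := by
    rw [hθ, div_le_iff₀ (by positivity)]
    refine (sq_le_sq₀ hβ0 (by positivity)).1 ?_
    rw [hβ2]
    have h1 := two_mul_log_le (N := N) (by omega)
    rw [← hL] at h1
    have h2 : 64 * (1 + lam) * N * (2 * L) ≤ 64 * (1 + lam) * N * (N * (1 + lam)) := by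
      refine mul_le_mul_of_nonneg_left ?_ (by positivity)
      nlinarith
    nlinarith
  have hexp8 : Real.exp (-(θ * β)) = 1 / (N : ℝ) ^ 8 := by
    rw [hθβ, Real.exp_neg, show 8 * L = ((8 : ℕ) : ℝ) * L by norm_num, Real.exp_nat_mul, hL,
      Real.exp_log hN', one_div]
  have hexp4 : Real.exp (-(θ * β / 2)) = 1 / (N : ℝ) ^ 4 := by
    rw [hθβ, Real.exp_neg, show 8 * L / 2 = ((4 : ℕ) : ℝ) * L by push_cast; ring,
      Real.exp_nat_mul, hL, Real.exp_log hN', one_div]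
  -- Only `β ≥ 4` is needed here: a bound of order 1/N suffices, since the correction is of order
  -- N⁻².
  have hθlow : 1 / (4 * N * (1 + lam)) ≤ θ := by
    rw [hθ, div_le_div_iff₀ (by positivity) (by positivity)]
    nlinarith [mul_pos hN' (by linarith : 0 < 1 + lam)]
  have hsmall : Real.exp (-(θ * β / 2)) * (2 + lam) * (N * (N + 1)) ≤ θ / (4 * (1 + lam)) := by
    calc Real.exp (-(θ * β / 2)) * (2 + lam) * (N * (N + 1))
        ≤ 1 / (N : ℝ) ^ 4 * (2 + lam) * (N * (2 * N)) := by
          rw [hexp4]; gcongr; linarith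
      _ = 2 * (2 + lam) / (N : ℝ) ^ 2 := by field_simp
      _ ≤ 2 * (2 + lam) / (N * (32 * (2 + lam) * (1 + lam) ^ 2)) := by
          rw [sq (N : ℝ)]; gcongr
      _ = 1 / (4 * N * (1 + lam)) / (4 * (1 + lam)) := by field_simp; norm_num
      _ ≤ θ / (4 * (1 + lam)) := by gcongr
  refine (hμ.one_sub_countProb_le hlam (by omega) hθ0 hθ' hβθ hβ4 hsmall).trans ?_
  rw [hexp8, hθβ, ← add_div]
  have hnum : 1 / (N : ℝ) ^ 8 * (2 + lam) * (N * (N + 1) + 2) * (2 * N) ≤ 4 * (2 + lam) := by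
    have h1 : ((N : ℝ) * (N + 1) + 2) * (2 * N) ≤ 4 * N ^ 8 := by
      have h2 : ((N : ℝ) * (N + 1) + 2) * (2 * N) ≤ 4 * N ^ 3 := by
        have h4 : (0 : ℝ) ≤ 2 * N * ((N - 2) * (N + 1)) :=
          mul_nonneg (by positivity) (mul_nonneg (by linarith) (by linarith))
        linarith
      have h3 : (N : ℝ) ^ 3 ≤ N ^ 8 := pow_le_pow_right₀ (by linarith) (by norm_num)
      linarith
    calc _ = (2 + lam) * (((N : ℝ) * (N + 1) + 2) * (2 * N)) / N ^ 8 := by ring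
      _ ≤ (2 + lam) * (4 * N ^ 8) / N ^ 8 := by gcongr
      _ = 4 * (2 + lam) := by field_simp
  -- The numerators 4(2+λ) and 4(1+λ) over 8 log N add up to (3/2+λ)/log N, half the stated bound.
  rw [div_le_div_iff₀ (by positivity) (by positivity)]
  nlinarith

end CountProb

end ARW

theorem theorem1 (lam : ℝ) (hlam : 0 < lam) :
    (∀ N : ℕ, 1 ≤ N → ∃! μ : Finset (Fin N) → ℝ, ARW.IsStationary lam μ) ∧
    ∃ α : ℕ → ℝ,
      (α =O[atTop] fun N : ℕ => Real.sqrt ((N : ℝ) * Real.log (N : ℝ))) ∧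
      ∀ μ : (N : ℕ) → Finset (Fin N) → ℝ,
        (∀ N : ℕ, 1 ≤ N → ARW.IsStationary lam (μ N)) →
        Tendsto
          (fun N : ℕ => ARW.countProb (μ N)
            (lam / (1 + lam) * (N : ℝ) - α N) (lam / (1 + lam) * (N : ℝ) + α N))
          atTop (𝓝 1) := by
  refine ⟨fun N hN => ARW.existsUnique_isStationary hN hlam,
    fun N => 2 * (Real.sqrt (128 * (1 + lam)) * Real.sqrt (N * Real.log N)), ?_, ?_⟩
  · simp only [← mul_assoc]
    exact (isBigO_refl _ _).const_mul_left _
  intro μ hμ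
  have hlog : Tendsto (fun N : ℕ => Real.log N) atTop atTop :=
    Real.tendsto_log_atTop.comp tendsto_natCast_atTop_atTop
  have hlow : Tendsto (fun N : ℕ => 1 - (3 + 2 * lam) / Real.log N) atTop (𝓝 1) := by
    simpa using (tendsto_const_nhds (x := (1 : ℝ))).sub (hlog.const_div_atTop (3 + 2 * lam))
  refine tendsto_of_tendsto_of_tendsto_of_le_of_le' hlow tendsto_const_nhds ?_ ?_
  · filter_upwards [eventually_ge_atTop 3, tendsto_natCast_atTop_atTop.eventually_ge_atTop
      (32 * (2 + lam) * (1 + lam) ^ 2)] with N hN hlarge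
    have := (hμ N (by omega)).one_sub_countProb_le_div_log hlam hN hlarge rfl
    linarith
  · filter_upwards [eventually_ge_atTop 1] with N hN
    exact ARW.countProb_le_one (hμ N hN).1 _ _
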